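/- Let $n\ge 4$, let $S_n$ be the symmetric group on $\{1,\dots,n\}$ and let $A=\mathbb C(S_n)$ be its group algebra with basis $\lambda(g)$, $g\in S_n$, regarded as the $C^*$-algebra generated by the left regular representation (so $\lambda(g)^*=\lambda(g^{-1})$), with its cocommutative Kac algebra structure $\Delta(\lambda(g))=\lambda(g)\otimes\lambda(g)$, $\varepsilon(\lambda(g))=1$, $\kappa(\lambda(g))=\lambda(g^{-1})$ and $\mu\bigl(\sum_g f(g)\lambda(g)\bigr)=f(e)$. Put $a=(12)$, $b=(34)$, $H=\{e,a,b,ab\}\cong\mathbb Z_2\times\mathbb Z_2$, and let $\hat H=\{\hat e,\hat a,\hat b,\hat a\hat b\}$ be the dual group, where $\langle\hat a,a\rangle=-1$, $\langle\hat a,b\rangle=1$, $\langle\hat b,a\rangle=1$, $\langle\hat b,b\rangle=-1$. For $x\in\hat H$ put $P_x=\frac14\sum_{h\in H}\langle x,h\rangle\lambda(h)$. Define $\omega:\hat H\times\hat H\to\mathbb T$ by $\omega(\hat a,\hat b)=\omega(\hat b,\hat a\hat b)=\omega(\hat a\hat b,\hat a)=i$, $\omega(\hat e,x)=\omega(x,\hat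 e)=\omega(x,x)=1$ and $\omega(x,y)=\overline{\omega(y,x)}$, and put $\Omega=\sum_{x,y\in\hat H}\omega(x,y)\,P_x\otimes P_y\in A\otimes A$. Let $\Delta_\Omega(x)=\Omega\Delta(x)\Omega^*$ and $\kappa_\Omega(x)=u\kappa(x)u^*$, where $u=m(\mathrm{id}\otimes\kappa)(\Omega)$ and $m$ is the multiplication of $A$. Let $\Sigma$ denote the flip $x\otimes y\mapsto y\otimes x$. Then $\Omega$ is a unitary counital 2-cocycle of $(A,\Delta,\varepsilon)$, that is, $(\Omega\otimes1)(\Delta\otimes\mathrm{id})(\Omega)=(1\otimes\Omega)(\mathrm{id}\otimes\Delta)(\Omega)$ and $(\varepsilon\otimes\mathrm{id})(\Omega)=(\mathrm{id}\otimes\varepsilon)(\Omega)=1$; $\mathcal A_\Omega=(A,\Delta_\Omega,\varepsilon,\kappa_\Omega,\mu)$ is a finite-dimensional Kac algebra; and it is non-symmetric, $\Sigma\circ\Delta_\Omega\ne\Delta_\Omega$. The map $\gamma(\lambda(g))=\lambda(aga^{-1})$ defines an automorphism of the Kac algebra $\mathcal A_\Omega$ of order $2$. Put $\Gamma=\{\mathrm{id},\gamma\}$,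 $P=\frac12(\mathrm{id}+\gamma)$, $B=P(A)=\{x\in A:\gamma(x)=x\}$ and $\tilde\Delta_\Omega=(P\otimes P)\circ\Delta_\Omega|_B:B\to B\otimes B$. Then: 1. $B$, with the comultiplication $\tilde\Delta_\Omega$, the restriction of $\varepsilon$, the antilinear involution $b^\star=\kappa_\Omega(b)^*$, the trivial one-parameter group $\sigma_t=\mathrm{id}$ and the restriction of $\mu$ as Haar measure, is a compact quantum hypergroup (the Delsart hypergroup of $\mathcal A_\Omega$ and $\Gamma$). This means: $\tilde\Delta_\Omega$ is coassociative with counit $\varepsilon$; $\star$ is involutive, multiplicative, commutes with $*$, and satisfies $\tilde\Delta_\Omega\circ\star=\Sigma\circ(\star\otimes\star)\circ\tilde\Delta_\Omega$; $\tilde\Delta_\Omega$ is unital, completely positive and commutes with $*$; $\varepsilon$ is multiplicative; $B$ is linearly spanned by its positive definite elements, i.e. those $x\in B$ with $(\xi\otimes\xi^+)\tilde\Delta_\Omega(x)\ge0$ for all linear functionals $\xi$ on $B$, where $\xi^+(y)=\overline{\xi(y^\star)}$; $\mu$ is a faithful state, $(\mu\otimes\mathrm{id})\tilde\Delta_\Omega(x)=(\mathrm{id}\otimes\mu)\tilde\Delta_\Omega(x)=\mu(x)1$;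 $\sigma$ extends to an entire one-parameter group $\sigma_z$ of automorphisms that is compatible with $\tilde\Delta_\Omega$ and preserves $\mu$; and, for some $z_0\in\mathbb C$, the strong invariance $(\mathrm{id}\otimes\mu)\bigl[((*\circ\sigma_{z_0}\circ\star)\otimes\mathrm{id})\tilde\Delta_\Omega(x)\cdot(1\otimes y)\bigr]=(\mathrm{id}\otimes\mu)\bigl[(1\otimes x)\tilde\Delta_\Omega(y)\bigr]$ holds for all $x,y\in B$. 2. The algebra $B$ is noncommutative. 3. $\dim B=\frac12(n^2-n+2)\,(n-2)!$. 4. The comultiplication $\tilde\Delta_\Omega$ is not symmetric: $\Sigma\circ\tilde\Delta_\Omega\ne\tilde\Delta_\Omega$. -/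

import Mathlib

open scoped TensorProduct ComplexOrder

/-! ## Finite-dimensional C*-algebras, positivity -/

section General

variable {A : Type*} [Ring A] [StarRing A] [Algebra ℂ A] [StarModule ℂ A]

/-- A complex *-algebra is a finite-dimensional C*-algebra: it is finite-dimensional and carries a
submultiplicative norm with the C*-identity (completeness is automatic, and the norm is unique). -/
def IsFinDimCStarAlgebra (A : Type*) [Ring A] [StarRing A] [Algebra ℂ A] : Prop :=
  FiniteDimensional ℂ A ∧ ∃ N : AlgebraNorm ℂ A, ∀ a : A, N (star a * a) = N a * N a

/-- Positive elements: finite sums of elements `star s * s`. In a C*-algebra this is the usual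
cone of positive elements. For finite-dimensional C*-algebras `A`, both `A ⊗[ℂ] A` and the matrix
algebras over these are again (finite-dimensional) C*-algebras, so the notion applies to them. -/
def IsPosElt {R : Type*} [NonUnitalSemiring R] [StarRing R] (a : R) : Prop :=
  a ∈ AddSubmonoid.closure (Set.range fun s : R => star s * s)

/-- Complete positivity of a linear map between *-algebras. -/
def IsCompletelyPositive {B : Type*} [Ring B] [StarRing B] [Algebra ℂ B] (f : A →ₗ[ℂ] B) : Prop :=
  ∀ (k : ℕ) (X : Matrix (Fin k) (Fin k) A), IsPosElt X → IsPosElt (X.map f)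

/-- The flip on the tensor square. -/
noncomputable def tensorFlip (A : Type*) [AddCommMonoid A] [Module ℂ A] :
    A ⊗[ℂ] A →ₗ[ℂ] A ⊗[ℂ] A :=
  (TensorProduct.comm ℂ A A).toLinearMap

/-- The slice map `f ⊗ id : A ⊗ A → A`. -/
noncomputable def sliceLeft (f : A →ₗ[ℂ] ℂ) : A ⊗[ℂ] A →ₗ[ℂ] A :=
  (TensorProduct.lid ℂ A).toLinearMap ∘ₗ f.rTensor A

/-- The slice map `id ⊗ f : A ⊗ A → A`. -/
noncomputable def sliceRight (f : A →ₗ[ℂ] ℂ) : A ⊗[ℂ] A →ₗ[ℂ] A :=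
  (TensorProduct.rid ℂ A).toLinearMap ∘ₗ f.lTensor A

/-- Coassociativity of `Δ` together with the counit property of `ε`. -/
structure IsCoalgebraStructure (Δ : A →ₗ[ℂ] A ⊗[ℂ] A) (ε : A →ₗ[ℂ] ℂ) : Prop where
  coassoc : ∀ a, TensorProduct.assoc ℂ A A A (Δ.rTensor A (Δ a)) = Δ.lTensor A (Δ a)
  counit_left : ∀ a, sliceLeft ε (Δ a) = a
  counit_right : ∀ a, sliceRight ε (Δ a) = a

/-- `μ` is a Haar measure: an invariant state. -/
structure IsHaarState (Δ : A →ₗ[ℂ] A ⊗[ℂ] A) (μ : A →ₗ[ℂ] ℂ) : Prop where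
  map_one : μ 1 = 1
  nonneg : ∀ a, IsPosElt a → 0 ≤ μ a
  left_inv : ∀ a, sliceLeft μ (Δ a) = μ a • (1 : A)
  right_inv : ∀ a, sliceRight μ (Δ a) = μ a • (1 : A)

/-! ## Compact quantum hypergroups of finite dimension -/

/-- A hypergroup structure `(A, Δ, ε, ⋆)`; here `st` is the antilinear involution `⋆`, while `star`
is the involution `*` of the C*-algebra. -/
structure IsHypergroupStructure (Δ : A →ₗ[ℂ] A ⊗[ℂ] A) (ε : A →ₗ[ℂ] ℂ) (st : A →ₗ⋆[ℂ] A) : Prop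
    extends IsCoalgebraStructure Δ ε where
  comul_st : ∀ a, Δ (st a) = tensorFlip A (TensorProduct.map st st (Δ a))
  st_st : ∀ a, st (st a) = a
  comul_pos : ∀ a, IsPosElt a → IsPosElt (Δ a)
  st_mul : ∀ a b, st (a * b) = st a * st b
  comul_star : ∀ a, Δ (star a) = star (Δ a)
  counit_mul : ∀ a b, ε (a * b) = ε a * ε b
  comul_one : Δ 1 = 1
  st_star : ∀ a, st (star a) = star (st a)

/-- The product `ξ · η = (ξ ⊗ η) ∘ Δ` of functionals. -/
noncomputable def funConv (Δ : A →ₗ[ℂ] A ⊗[ℂ] A) (ξ η : A →ₗ[ℂ] ℂ) : A →ₗ[ℂ] ℂ :=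
  LinearMap.mul' ℂ ℂ ∘ₗ TensorProduct.map ξ η ∘ₗ Δ

/-- The involution `ξ⁺(a) = conj (ξ (a⋆))` of functionals. -/
noncomputable def funInvol (st : A →ₗ⋆[ℂ] A) (ξ : A →ₗ[ℂ] ℂ) : A →ₗ[ℂ] ℂ :=
  (starLinearEquiv ℂ (A := ℂ)).toLinearMap.comp (ξ.comp st)

/-- Positive definite elements: `(ξ · ξ⁺)(a) ≥ 0` for all functionals `ξ`. -/
def IsPositiveDefinite (Δ : A →ₗ[ℂ] A ⊗[ℂ] A) (st : A →ₗ⋆[ℂ] A) (a : A) : Prop :=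
  ∀ ξ : A →ₗ[ℂ] ℂ, 0 ≤ funConv Δ ξ (funInvol st ξ) a

/-- The antipode `* ∘ σ ∘ ⋆`. -/
noncomputable def antipodeOf (st : A →ₗ⋆[ℂ] A) (σ : A ≃ₐ[ℂ] A) : A →ₗ[ℂ] A :=
  (starLinearEquiv ℂ (A := A)).toLinearMap.comp (σ.toLinearMap.comp st)

/-- `(A, Δ, ε, ⋆, σ, μ)` is a compact quantum hypergroup on a finite-dimensional C*-algebra.
In finite dimension every dense subspace is the whole space, so the dense subalgebras of `A` and of
`A ⊗ A` on which the complex powers act are the whole algebras. The one-parameter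
group is given with its (unique) entire extension `z ↦ σ z`. -/
structure IsCompactQuantumHypergroup (Δ : A →ₗ[ℂ] A ⊗[ℂ] A) (ε : A →ₗ[ℂ] ℂ) (st : A →ₗ⋆[ℂ] A)
    (σ : ℂ → (A ≃ₐ[ℂ] A)) (μ : A →ₗ[ℂ] ℂ) : Prop extends IsHypergroupStructure Δ ε st where
  cstar : IsFinDimCStarAlgebra A
  completelyPositive : IsCompletelyPositive Δ
  span_posDef : Submodule.span ℂ {a | IsPositiveDefinite Δ st a} = ⊤
  sigma_add : ∀ z w, σ (z + w) = σ z * σ w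
  sigma_star : ∀ (t : ℝ) (a : A), σ t (star a) = star (σ t a)
  sigma_entire : ∀ (a : A) (φ : A →ₗ[ℂ] ℂ), Differentiable ℂ fun z => φ (σ z a)
  comul_sigma : ∀ z a,
    Δ (σ z a) = TensorProduct.map (σ z).toLinearMap (σ z).toLinearMap (Δ a)
  haar_sigma : ∀ z a, μ (σ z a) = μ a
  haar : IsHaarState Δ μ
  strong_inv : ∃ z₀ : ℂ, ∀ a b : A,
    sliceRight μ ((antipodeOf st (σ z₀)).rTensor A (Δ a) * (1 ⊗ₜ[ℂ] b)) =
      sliceRight μ ((1 ⊗ₜ[ℂ] a) * Δ b)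
  haar_faithful : ∀ a : A, μ (star a * a) = 0 → a = 0

/-! ## Finite-dimensional Kac algebras, their automorphisms and 2-cocycles -/

/-- `(A, Δ, ε, κ, μ)` is a finite-dimensional Kac algebra: a finite-dimensional C*-algebra with a
coassociative unital *-homomorphism `Δ`, a counit `ε`, an involutive antipode `κ` and a faithful
invariant trace `μ`. -/
structure IsKacAlgebra (Δ : A →ₗ[ℂ] A ⊗[ℂ] A) (ε : A →ₗ[ℂ] ℂ) (κ : A →ₗ[ℂ] A)
    (μ : A →ₗ[ℂ] ℂ) : Prop extends IsCoalgebraStructure Δ ε where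
  cstar : IsFinDimCStarAlgebra A
  comul_one : Δ 1 = 1
  comul_mul : ∀ a b, Δ (a * b) = Δ a * Δ b
  comul_star : ∀ a, Δ (star a) = star (Δ a)
  counit_one : ε 1 = 1
  counit_mul : ∀ a b, ε (a * b) = ε a * ε b
  counit_star : ∀ a, ε (star a) = star (ε a)
  antipode_mul : ∀ a b, κ (a * b) = κ b * κ a
  antipode_star : ∀ a, κ (star a) = star (κ a)
  antipode_antipode : ∀ a, κ (κ a) = a
  comul_antipode : ∀ a, Δ (κ a) = tensorFlip A (TensorProduct.map κ κ (Δ a))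
  mul_antipode_left : ∀ a, LinearMap.mul' ℂ A (κ.rTensor A (Δ a)) = algebraMap ℂ A (ε a)
  mul_antipode_right : ∀ a, LinearMap.mul' ℂ A (κ.lTensor A (Δ a)) = algebraMap ℂ A (ε a)
  haar : IsHaarState Δ μ
  haar_trace : ∀ a b, μ (a * b) = μ (b * a)
  haar_faithful : ∀ a : A, μ (star a * a) = 0 → a = 0
  haar_antipode : ∀ a, μ (κ a) = μ a
  strong_inv : ∀ a b : A,
    sliceRight μ (κ.rTensor A (Δ a) * (1 ⊗ₜ[ℂ] b)) = sliceRight μ ((1 ⊗ₜ[ℂ] a) * Δ b)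

/-- A *-automorphism of `A` is an automorphism of the Kac algebra `(A, Δ, ε, κ)`. -/
structure IsKacAutomorphism (Δ : A →ₗ[ℂ] A ⊗[ℂ] A) (ε : A →ₗ[ℂ] ℂ) (κ : A →ₗ[ℂ] A)
    (γ : A ≃⋆ₐ[ℂ] A) : Prop where
  comul : ∀ a, Δ (γ a) = TensorProduct.map
    (γ.toAlgEquiv.toLinearMap) (γ.toAlgEquiv.toLinearMap) (Δ a)
  counit : ∀ a, ε (γ a) = ε a
  antipode : ∀ a, γ (κ a) = κ (γ a)

/-- `Ω ∈ A ⊗ A` is a counital (unitary) 2-cocycle with respect to `Δ`. -/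
structure IsCounitalTwoCocycle (Δ : A →ₗ[ℂ] A ⊗[ℂ] A) (ε : A →ₗ[ℂ] ℂ) (Ω : A ⊗[ℂ] A) : Prop where
  unitary : Ω ∈ unitary (A ⊗[ℂ] A)
  cocycle : TensorProduct.assoc ℂ A A A ((Ω ⊗ₜ[ℂ] (1 : A)) * Δ.rTensor A Ω) =
    ((1 : A) ⊗ₜ[ℂ] Ω) * Δ.lTensor A Ω
  counit_left : sliceLeft ε Ω = 1
  counit_right : sliceRight ε Ω = 1

/-- The twisted comultiplication `Δ_Ω(x) = Ω Δ(x) Ω*`. -/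
noncomputable def twistComul (Δ : A →ₗ[ℂ] A ⊗[ℂ] A) (Ω : A ⊗[ℂ] A) : A →ₗ[ℂ] A ⊗[ℂ] A :=
  LinearMap.mulLeft ℂ Ω ∘ₗ LinearMap.mulRight ℂ (star Ω) ∘ₗ Δ

/-- The element `u = m (id ⊗ κ) Ω`. -/
noncomputable def twistUnitary (κ : A →ₗ[ℂ] A) (Ω : A ⊗[ℂ] A) : A :=
  LinearMap.mul' ℂ A (κ.lTensor A Ω)

/-- The twisted antipode `κ_Ω(x) = u κ(x) u*`. -/
noncomputable def twistAntipode (κ : A →ₗ[ℂ] A) (Ω : A ⊗[ℂ] A) : A →ₗ[ℂ] A :=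
  LinearMap.mulLeft ℂ (twistUnitary κ Ω) ∘ₗ
    LinearMap.mulRight ℂ (star (twistUnitary κ Ω)) ∘ₗ κ

/-! ## The Delsart construction for a finite group of automorphisms -/

/-- The fixed point algebra of a group of *-automorphisms. -/
def fixedAlgebra (Γ : Subgroup (A ≃⋆ₐ[ℂ] A)) : StarSubalgebra ℂ A where
  carrier := {a | ∀ γ ∈ Γ, γ a = a}
  mul_mem' ha hb γ hγ := by rw [map_mul, ha γ hγ, hb γ hγ]
  add_mem' ha hb γ hγ := by rw [map_add, ha γ hγ, hb γ hγ]
  algebraMap_mem' r γ _ := by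
    rw [Algebra.algebraMap_eq_smul_one, map_smul, map_one]
  star_mem' ha γ hγ := by rw [map_star, ha γ hγ]

/-- The inclusion of the fixed point algebra, as a linear map. -/
def fixedInclusion (Γ : Subgroup (A ≃⋆ₐ[ℂ] A)) : fixedAlgebra Γ →ₗ[ℂ] A where
  toFun b := b
  map_add' _ _ := rfl
  map_smul' _ _ := rfl

open Classical in
/-- The conditional expectation `P a = |Γ|⁻¹ ∑_{γ ∈ Γ} γ a` of `A` onto the fixed point algebra. -/
noncomputable def fixedExpectation (Γ : Subgroup (A ≃⋆ₐ[ℂ] A)) [Fintype Γ] :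
    A →ₗ[ℂ] fixedAlgebra Γ where
  toFun a := ⟨(Fintype.card Γ : ℂ)⁻¹ • ∑ γ : Γ, (γ : A ≃⋆ₐ[ℂ] A) a, by
    intro δ hδ
    rw [map_smul, map_sum]
    congr 1
    exact Fintype.sum_equiv (Equiv.mulLeft (⟨δ, hδ⟩ : Γ)) _ _ fun γ => rfl⟩
  map_add' a b := by
    ext
    simp [Finset.sum_add_distrib, smul_add]
  map_smul' c a := by
    ext
    simp only [map_smul, ← Finset.smul_sum, RingHom.id_apply]
    exact smul_comm _ _ _

/-- The comultiplication `(P ⊗ P) ∘ Δ` on the fixed point algebra. -/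
noncomputable def delsartComul (Γ : Subgroup (A ≃⋆ₐ[ℂ] A)) [Fintype Γ] (Δ : A →ₗ[ℂ] A ⊗[ℂ] A) :
    fixedAlgebra Γ →ₗ[ℂ] fixedAlgebra Γ ⊗[ℂ] fixedAlgebra Γ :=
  TensorProduct.map (fixedExpectation Γ) (fixedExpectation Γ) ∘ₗ Δ ∘ₗ fixedInclusion Γ

/-- The involution `b⋆ = κ(b)*` on the fixed point algebra. Since `κ` and `*` commute with the
automorphisms, `κ(b)*` is already a fixed point and `P` only adjusts the codomain; see `star_coe`
in `IsDelsartHypergroup`. -/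
noncomputable def delsartStar (Γ : Subgroup (A ≃⋆ₐ[ℂ] A)) [Fintype Γ] (κ : A →ₗ[ℂ] A) :
    fixedAlgebra Γ →ₗ⋆[ℂ] fixedAlgebra Γ :=
  (fixedExpectation Γ).comp
    ((starLinearEquiv ℂ (A := A)).toLinearMap.comp (κ.comp (fixedInclusion Γ)))

/-- The Delsart construction for a finite group `Γ` acting on a finite-dimensional Kac algebra:
`Γ` consists of automorphisms of the Kac algebra, and the fixed point algebra with the
comultiplication `(P ⊗ P) ∘ Δ` and the restrictions of `ε`, `⋆`, `σ`, `μ` is a compact quantum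
hypergroup. On a Kac algebra, `a⋆ = κ(a)*` and the group `σ` is trivial. -/
structure IsDelsartHypergroup (Γ : Subgroup (A ≃⋆ₐ[ℂ] A)) [Fintype Γ]
    (Δ : A →ₗ[ℂ] A ⊗[ℂ] A) (ε : A →ₗ[ℂ] ℂ) (κ : A →ₗ[ℂ] A) (μ : A →ₗ[ℂ] ℂ) : Prop where
  kac : IsKacAlgebra Δ ε κ μ
  automorphism : ∀ γ ∈ Γ, IsKacAutomorphism Δ ε κ γ
  star_coe : ∀ b : fixedAlgebra Γ, (delsartStar Γ κ b : A) = star (κ b)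
  hypergroup : IsCompactQuantumHypergroup (delsartComul Γ Δ) (ε ∘ₗ fixedInclusion Γ)
    (delsartStar Γ κ) (fun _ => 1) (μ ∘ₗ fixedInclusion Γ)

end General

/-! ## The *-algebra of a group -/

section GroupAlgebra

variable {G : Type*} [Group G]

/-- The involution of the complex group algebra: `(∑ c_g λ(g))* = ∑ conj(c_g) λ(g⁻¹)`. For a finite
group this is the adjoint of operators in the left regular representation. -/
noncomputable instance groupAlgebraStar : Star (MonoidAlgebra ℂ G) where
  star x := .ofCoeff
    (Finsupp.mapRange star (star_zero ℂ) (Finsupp.equivMapDomain (Equiv.inv G) x.coeff))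

theorem coeff_groupAlgebra_star (x : MonoidAlgebra ℂ G) (g : G) :
    (star x).coeff g = star (x.coeff g⁻¹) := by
  simp [star]

theorem star_groupAlgebra_single (g : G) (c : ℂ) :
    star (MonoidAlgebra.single g c) = MonoidAlgebra.single g⁻¹ (star c) := by
  ext h
  rw [coeff_groupAlgebra_star]
  classical
  by_cases hh : g = h⁻¹
  · subst hh; simp
  · have : g⁻¹ ≠ h := fun e => hh (by rw [← e, inv_inv])
    simp [MonoidAlgebra.coeff_single, hh, this]

theorem star_groupAlgebra_add (x y : MonoidAlgebra ℂ G) : star (x + y) = star x + star y := by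
  ext g
  simp [coeff_groupAlgebra_star]

noncomputable instance groupAlgebraStarRing : StarRing (MonoidAlgebra ℂ G) where
  star_involutive x := by
    ext g
    simp [coeff_groupAlgebra_star]
  star_add := star_groupAlgebra_add
  star_mul x y := by
    have hz : star (0 : MonoidAlgebra ℂ G) = 0 := by
      ext g; simp [coeff_groupAlgebra_star]
    induction x using MonoidAlgebra.induction_linear with
    | zero => simp [hz]
    | add x₁ x₂ h₁ h₂ => rw [add_mul, star_groupAlgebra_add, star_groupAlgebra_add, h₁, h₂, mul_add]
    | single g c =>
      induction y using MonoidAlgebra.induction_linear with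
      | zero => simp [hz]
      | add y₁ y₂ h₁ h₂ =>
        rw [mul_add, star_groupAlgebra_add, star_groupAlgebra_add, h₁, h₂, add_mul]
      | single h d =>
        simp [MonoidAlgebra.single_mul_single, star_groupAlgebra_single, mul_comm]

noncomputable instance groupAlgebraStarModule : StarModule ℂ (MonoidAlgebra ℂ G) where
  star_smul c x := by
    ext g
    simp [coeff_groupAlgebra_star]

/-- The basis element `λ(g)` of the group algebra. -/
noncomputable def grpElt (g : G) : MonoidAlgebra ℂ G := MonoidAlgebra.single g 1

/-- The canonical trace `μ(λ(f)) = f(e)`. -/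
noncomputable def groupTrace (G : Type*) [Group G] : MonoidAlgebra ℂ G →ₗ[ℂ] ℂ where
  toFun x := x.coeff 1
  map_add' _ _ := rfl
  map_smul' _ _ := rfl

/-- The *-automorphism `λ(g) ↦ λ(φ(g))` induced by a group automorphism `φ`. -/
noncomputable def groupStarAut (φ : G ≃* G) : MonoidAlgebra ℂ G ≃⋆ₐ[ℂ] MonoidAlgebra ℂ G :=
  StarAlgEquiv.ofAlgEquiv (MonoidAlgebra.domCongr ℂ ℂ φ) fun x => by
    ext g
    simp [coeff_groupAlgebra_star]

end GroupAlgebra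

/-! ## The twisting of the symmetric group -/

section SymmetricGroup

variable {n : ℕ}

/-- The permutation `a = (12)` of `{1, …, n}` (indexed from zero). -/
def permA (hn : 4 ≤ n) : Equiv.Perm (Fin n) := Equiv.swap ⟨0, by omega⟩ ⟨1, by omega⟩

/-- The permutation `b = (34)` of `{1, …, n}` (indexed from zero). -/
def permB (hn : 4 ≤ n) : Equiv.Perm (Fin n) := Equiv.swap ⟨2, by omega⟩ ⟨3, by omega⟩

/-- Index set for `H = {a^p b^q}` and for its dual group: `(s, t)` stands for the character
`a^p b^q ↦ (-1)^(s p + t q)`, so that `â = (1, 0)` and `b̂ = (0, 1)`. -/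
abbrev Klein : Type := ZMod 2 × ZMod 2

/-- The pairing of the dual group with `H`. -/
def kleinPairing (x k : Klein) : ℂ := (-1) ^ (x.1.val * k.1.val + x.2.val * k.2.val)

/-- The spectral projection `P_x = |H|⁻¹ ∑_{h ∈ H} ⟨x, h⟩ λ(h)` (the characters are real). -/
noncomputable def dualProj (hn : 4 ≤ n) (x : Klein) : MonoidAlgebra ℂ (Equiv.Perm (Fin n)) :=
  (1 / 4 : ℂ) • ∑ k : Klein,
    kleinPairing x k • grpElt (permA hn ^ k.1.val * permB hn ^ k.2.val)

/-- The 2-cocycle on the dual group: `ω(â, b̂) = ω(b̂, âb̂) = ω(âb̂, â) = i`,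
`ω(ê, x) = ω(x, ê) = ω(x, x) = 1`, and `ω(x, y) = conj ω(y, x)`. -/
noncomputable def kleinCocycle (x y : Klein) : ℂ :=
  if x = 0 ∨ y = 0 ∨ x = y then 1
  else if (x = (1, 0) ∧ y = (0, 1)) ∨ (x = (0, 1) ∧ y = (1, 1)) ∨ (x = (1, 1) ∧ y = (1, 0))
    then Complex.I
  else -Complex.I

/-- The lifted 2-cocycle `Ω = ∑_{x, y} ω(x, y) P_x ⊗ P_y`. -/
noncomputable def symOmega (hn : 4 ≤ n) :
    MonoidAlgebra ℂ (Equiv.Perm (Fin n)) ⊗[ℂ] MonoidAlgebra ℂ (Equiv.Perm (Fin n)) :=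
  ∑ x : Klein, ∑ y : Klein, kleinCocycle x y • (dualProj hn x ⊗ₜ[ℂ] dualProj hn y)

/-- The twisted comultiplication on `ℂ(S_n)`. -/
noncomputable def symComul (hn : 4 ≤ n) :
    MonoidAlgebra ℂ (Equiv.Perm (Fin n)) →ₗ[ℂ]
      MonoidAlgebra ℂ (Equiv.Perm (Fin n)) ⊗[ℂ] MonoidAlgebra ℂ (Equiv.Perm (Fin n)) :=
  twistComul Coalgebra.comul (symOmega hn)

/-- The counit on `ℂ(S_n)`. -/
noncomputable def symCounit (n : ℕ) : MonoidAlgebra ℂ (Equiv.Perm (Fin n)) →ₗ[ℂ] ℂ :=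
  Coalgebra.counit

/-- The twisted antipode on `ℂ(S_n)`. -/
noncomputable def symAntipode (hn : 4 ≤ n) :
    MonoidAlgebra ℂ (Equiv.Perm (Fin n)) →ₗ[ℂ] MonoidAlgebra ℂ (Equiv.Perm (Fin n)) :=
  twistAntipode (HopfAlgebra.antipode ℂ) (symOmega hn)

/-- The automorphism `γ` of `ℂ(S_n)` induced by conjugation by `(12)`. -/
noncomputable def symGamma (hn : 4 ≤ n) :
    MonoidAlgebra ℂ (Equiv.Perm (Fin n)) ≃⋆ₐ[ℂ] MonoidAlgebra ℂ (Equiv.Perm (Fin n)) :=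
  groupStarAut (MulAut.conj (permA hn))

theorem symGamma_mul_self (hn : 4 ≤ n) : symGamma hn * symGamma hn = 1 := by
  ext x g
  simp only [StarAlgEquiv.mul_apply, StarAlgEquiv.one_apply]
  change ((MonoidAlgebra.domCongr ℂ ℂ (MulAut.conj (permA hn)))
    ((MonoidAlgebra.domCongr ℂ ℂ (MulAut.conj (permA hn))) x)).coeff g = x.coeff g
  have ha : permA hn * permA hn = 1 := Equiv.swap_mul_self _ _
  have hi : (permA hn)⁻¹ = permA hn := inv_eq_of_mul_eq_one_left ha
  rw [MonoidAlgebra.coeff_domCongr, MonoidAlgebra.coeff_domCongr, MulAut.conj_symm_apply,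
    MulAut.conj_symm_apply, hi]
  congr 1
  rw [← mul_assoc, ← mul_assoc, ha, one_mul, mul_assoc, ha, mul_one]

/-- The group `Γ = {id, γ}`. -/
noncomputable def symGroup (hn : 4 ≤ n) : Subgroup
    (MonoidAlgebra ℂ (Equiv.Perm (Fin n)) ≃⋆ₐ[ℂ] MonoidAlgebra ℂ (Equiv.Perm (Fin n))) where
  carrier := {1, symGamma hn}
  one_mem' := Or.inl rfl
  mul_mem' := by
    rintro x y (rfl | rfl) (rfl | rfl)
    · exact Or.inl (mul_one 1)
    · exact Or.inr (one_mul _)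
    · exact Or.inr (mul_one _)
    · exact Or.inl (symGamma_mul_self hn)
  inv_mem' := by
    rintro x (rfl | rfl)
    · exact Or.inl inv_one
    · exact Or.inr (inv_eq_of_mul_eq_one_left (symGamma_mul_self hn))

noncomputable instance symGroupFintype (hn : 4 ≤ n) : Fintype (symGroup hn) :=
  ((Set.finite_singleton (symGamma hn)).insert 1).fintype

end SymmetricGroup

/-! The argument joins a general principle to a computation with the characters of H.

General principle (`IsKacAlgebra.isDelsartHypergroup`): the average P over a finite group Γ of Kac
algebra automorphisms preserves ε and μ, commutes with κ and *, and is a bimodule map over the fixed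
algebra B. Coassociativity survives averaging because (P ⊗ id)Δ(b) = (id ⊗ P)Δ(b) for b in B
(`rTensor_fixedProjection_comul`). Complete positivity holds because P ⊗ P is an average of
*-automorphisms of A ⊗ A; positivity then passes down to B ⊗ B, since the square root of a positive
semidefinite matrix is a polynomial in it (`isPosElt_iff_of_injective`). Positive definite elements
span because strong invariance makes slicing by ξ⁺ the adjoint of slicing by ξ for the inner product
of μ (`span_isPositiveDefinite_eq_top`).

Computation: the P_x are orthogonal idempotents with sum 1 and Δ(P_w)(P_x ⊗ P_y) = δ_{w,x+y} P_x ⊗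
P_y, so Ω is diagonal with eigenvalues ω(x, y) and its cocycle identity is that of ω. As ω(x, x) =
1, the element u is 1: the antipode does not change and the antipode laws persist. The trace stays
invariant by orthogonality of the P_x and because μ(P_x λ(g)) = 0 for g outside H. The automorphism
γ is conjugation by λ(a) with a in H, so it fixes every P_x and hence Ω.

Asymmetry is seen in one corner of A ⊗ A cut out by the P_x, where the comultiplication of (23) and
its flip differ by the factor i/(-i) (`tensorFlip_delsartComul_ne`). The dimension of B is the trace
of P, which counts all permutations and those commuting with (12). -/

set_option linter.unusedSectionVars false

/-! ### Faithful matrix representations and positivity. -/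

section Representations

/-- A *-algebra with a faithful *-representation by complex matrices of finite size. -/
def HasFaithfulRep (R : Type*) [Ring R] [StarRing R] [Algebra ℂ R] : Prop :=
  ∃ (N : Type) (_ : Fintype N) (_ : DecidableEq N) (π : R →⋆ₐ[ℂ] Matrix N N ℂ),
    Function.Injective π

variable {R S : Type*} [Ring R] [StarRing R] [Algebra ℂ R] [Ring S] [StarRing S] [Algebra ℂ S]

theorem HasFaithfulRep.of_injective (h : HasFaithfulRep S) (f : R →⋆ₐ[ℂ] S)
    (hf : Function.Injective f) : HasFaithfulRep R := by
  obtain ⟨N, _, _, π, hπ⟩ := h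
  exact ⟨N, _, _, π.comp f, hπ.comp hf⟩

/-- The tensor product of two *-homomorphisms. -/
noncomputable def tensorStarHom {R' S' : Type*} [Ring R'] [StarRing R'] [Algebra ℂ R']
    [Ring S'] [StarRing S'] [Algebra ℂ S'] [StarModule ℂ R] [StarModule ℂ S] [StarModule ℂ R']
    [StarModule ℂ S'] (f : R →⋆ₐ[ℂ] R') (g : S →⋆ₐ[ℂ] S') : R ⊗[ℂ] S →⋆ₐ[ℂ] R' ⊗[ℂ] S' where
  __ := Algebra.TensorProduct.map f.toAlgHom g.toAlgHom
  map_star' x := by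
    induction x with
    | zero => simp
    | add x y hx hy => simp_all
    | tmul a b => simp [map_star]

theorem HasFaithfulRep.tensor [StarModule ℂ R] [StarModule ℂ S] (hR : HasFaithfulRep R)
    (hS : HasFaithfulRep S) : HasFaithfulRep (R ⊗[ℂ] S) := by
  obtain ⟨N, _, _, π, hπ⟩ := hR
  obtain ⟨M, _, _, ρ, hρ⟩ := hS
  refine ⟨N × M, _, _,
    ((Matrix.kroneckerStarAlgEquiv N M ℂ : _ ≃⋆ₐ[ℂ] _) : _ →⋆ₐ[ℂ] _).comp (tensorStarHom π ρ), ?_⟩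
  refine (Matrix.kroneckerStarAlgEquiv N M ℂ).injective.comp ?_
  exact TensorProduct.map_injective_of_flat_flat _ _ hπ hρ

/-- Entrywise application of a *-homomorphism to matrices. -/
def matrixStarHom {k : Type*} [Fintype k] [DecidableEq k] (f : R →⋆ₐ[ℂ] S) :
    Matrix k k R →⋆ₐ[ℂ] Matrix k k S where
  __ := f.toAlgHom.mapMatrix
  map_star' x := by
    ext i j
    simp [Matrix.star_apply, map_star]

theorem HasFaithfulRep.matrix {k : Type} [Fintype k] [DecidableEq k] (hR : HasFaithfulRep R) :
    HasFaithfulRep (Matrix k k R) := by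
  obtain ⟨N, _, _, π, hπ⟩ := hR
  let c : Matrix k k (Matrix N N ℂ) →⋆ₐ[ℂ] Matrix (k × N) (k × N) ℂ :=
    { (Matrix.compAlgEquiv k N ℂ ℂ : _ →ₐ[ℂ] _) with
      map_star' := fun x => by
        ext ⟨i, p⟩ ⟨j, q⟩
        simp [Matrix.star_apply, Matrix.compAlgEquiv, Matrix.compRingEquiv] }
  refine ⟨k × N, _, _, c.comp (matrixStarHom π), ?_⟩
  have hm : Function.Injective (matrixStarHom (k := k) π) := fun x y hxy => by
    ext i j
    exact hπ (congrFun (congrFun hxy i) j)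
  exact (Matrix.compAlgEquiv k N ℂ ℂ).injective.comp hm

/-- The C*-norm is the operator norm pulled back along the representation. -/
theorem HasFaithfulRep.isFinDimCStarAlgebra (h : HasFaithfulRep R) : IsFinDimCStarAlgebra R := by
  obtain ⟨N, _, _, π, hπ⟩ := h
  refine ⟨FiniteDimensional.of_injective (π : R →ₐ[ℂ] Matrix N N ℂ).toLinearMap hπ, ?_⟩
  open scoped Matrix.Norms.L2Operator in
  exact ⟨{
    toFun := fun x => ‖π x‖
    map_zero' := by simp
    add_le' := fun x y => by rw [map_add]; exact norm_add_le _ _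
    neg' := fun x => by rw [map_neg, norm_neg]
    mul_le' := fun x y => by rw [map_mul]; exact norm_mul_le _ _
    eq_zero_of_map_eq_zero' := fun x hx => hπ (by rw [map_zero]; exact norm_eq_zero.1 hx)
    smul' := fun c x => by rw [map_smul, norm_smul] },
    fun a => by
      change ‖π (star a * a)‖ = ‖π a‖ * ‖π a‖
      rw [map_mul, map_star]
      exact CStarRing.norm_star_mul_self⟩

theorem isPosElt_star_mul_self {R : Type*} [NonUnitalSemiring R] [StarRing R] (x : R) :
    IsPosElt (star x * x) :=
  AddSubmonoid.subset_closure ⟨x, rfl⟩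

theorem IsPosElt.induction {R : Type*} [NonUnitalSemiring R] [StarRing R] {p : R → Prop}
    (h0 : p 0) (hadd : ∀ x y, p x → p y → p (x + y)) (hs : ∀ s, p (star s * s)) {a : R}
    (ha : IsPosElt a) : p a := by
  refine AddSubmonoid.closure_induction (motive := fun x _ => p x) ?_ h0 (fun x y _ _ => hadd x y) ha
  rintro _ ⟨s, rfl⟩
  exact hs s

theorem isPosElt_zero {R : Type*} [NonUnitalSemiring R] [StarRing R] : IsPosElt (0 : R) := AddSubmonoid.zero_mem _

theorem IsPosElt.add {R : Type*} [NonUnitalSemiring R] [StarRing R] {a b : R} (ha : IsPosElt a) (hb : IsPosElt b) : IsPosElt (a + b) :=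
  AddSubmonoid.add_mem _ ha hb

theorem IsPosElt.map {a : R} (ha : IsPosElt a) (f : R →⋆ₐ[ℂ] S) : IsPosElt (f a) := by
  refine ha.induction (p := fun a => IsPosElt (f a)) (by simpa using isPosElt_zero)
    (fun x y hx hy => by simpa using hx.add hy) (fun s => ?_)
  simpa [map_star] using isPosElt_star_mul_self (f s)

theorem IsPosElt.posSemidef {N : Type*} [Fintype N] [DecidableEq N] {a : Matrix N N ℂ}
    (ha : IsPosElt a) : a.PosSemidef := by
  exact ha.induction (p := fun a : Matrix N N ℂ => a.PosSemidef) .zero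
    (fun x y hx hy => hx.add hy) fun s => Matrix.posSemidef_conjTranspose_mul_self s

/-- By the spectral theorem the matrix is the image of its diagonal of eigenvalues under an algebra
homomorphism, and polynomials commute with such maps. -/
theorem Matrix.IsHermitian.aeval_eq_zero {N : Type*} [Fintype N] [DecidableEq N]
    {a : Matrix N N ℂ} (ha : a.IsHermitian) (q : Polynomial ℂ)
    (hq : ∀ i, q.eval (ha.eigenvalues i : ℂ) = 0) : Polynomial.aeval a q = 0 := by
  have h := Polynomial.aeval_algHom_apply
    ((Unitary.conjStarAlgAut ℂ _ ha.eigenvectorUnitary).toAlgEquiv.toAlgHom.comp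
      (Matrix.diagonalAlgHom ℂ)) (RCLike.ofReal ∘ ha.eigenvalues) q
  have h0 : Polynomial.aeval ((RCLike.ofReal ∘ ha.eigenvalues : N → ℂ)) q = 0 := by
    ext i
    have := Polynomial.aeval_algHom_apply (Pi.evalAlgHom ℂ (fun _ : N => ℂ) i)
      (RCLike.ofReal ∘ ha.eigenvalues) q
    exact this.symm.trans (hq i)
  rw [h0, map_zero] at h
  refine Eq.trans ?_ h
  congr 1
  exact ha.spectral_theorem ▸ rfl

/-- A positive semidefinite matrix is the square of a real polynomial in it. -/
theorem Matrix.PosSemidef.exists_aeval_sq {N : Type*} [Fintype N] [DecidableEq N]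
    {a : Matrix N N ℂ} (ha : a.PosSemidef) :
    ∃ p : Polynomial ℝ, Polynomial.aeval a (p.map (algebraMap ℝ ℂ)) *
      Polynomial.aeval a (p.map (algebraMap ℝ ℂ)) = a := by
  -- Interpolation of the square root at the eigenvalues. Real coefficients make the value at a
  -- self-adjoint element self-adjoint again.
  let p := Lagrange.interpolate (Finset.univ.image ha.1.eigenvalues) id Real.sqrt
  refine ⟨p, ?_⟩
  have := ha.1.aeval_eq_zero (p.map (algebraMap ℝ ℂ) * p.map (algebraMap ℝ ℂ) - .X) fun i => by
    have hp : p.eval (ha.1.eigenvalues i) = Real.sqrt (ha.1.eigenvalues i) :=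
      Lagrange.eval_interpolate_at_node (v := id) _ Function.injective_id.injOn
        (Finset.mem_image_of_mem _ (Finset.mem_univ i))
    have he : (p.map (algebraMap ℝ ℂ)).eval (ha.1.eigenvalues i : ℂ) =
        (Real.sqrt (ha.1.eigenvalues i) : ℂ) := by
      rw [← hp]
      exact Polynomial.eval_map_apply (algebraMap ℝ ℂ) _
    rw [Polynomial.eval_sub, Polynomial.eval_mul, he, Polynomial.eval_X, ← Complex.ofReal_mul,
      Real.mul_self_sqrt (ha.eigenvalues_nonneg i), sub_self]
  simpa [sub_eq_zero] using this

/-- The square root of `π a` is a real polynomial in `π a`, so it already lies in the image of `R`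
and is self-adjoint there. -/
theorem IsPosElt.of_posSemidef [StarModule ℂ R] {N : Type*} [Fintype N] [DecidableEq N]
    (π : R →⋆ₐ[ℂ] Matrix N N ℂ) (hπ : Function.Injective π) {a : R} (ha : (π a).PosSemidef) :
    IsPosElt a := by
  obtain ⟨p, hp⟩ := ha.exists_aeval_sq
  have hstar : star a = a := hπ (by rw [map_star]; exact ha.1)
  let q := p.map (algebraMap ℝ ℂ)
  have hq : π (Polynomial.aeval a q) = Polynomial.aeval (π a) q :=
    (Polynomial.aeval_algHom_apply π a q).symm
  have hqs : star (Polynomial.aeval a q) = Polynomial.aeval a q := by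
    rw [Polynomial.aeval_eq_sum_range, star_sum]
    refine Finset.sum_congr rfl fun i _ => ?_
    rw [star_smul, star_pow, hstar]
    simp [q]
  have : a = star (Polynomial.aeval a q) * Polynomial.aeval a q := by
    apply hπ
    rw [hqs, map_mul, hq, hp]
  rw [this]
  exact isPosElt_star_mul_self _

/-- Positivity does not depend on the ambient algebra. This lets positivity in `B ⊗ B`, or in
matrices over it, be tested inside `A ⊗ A`. -/
theorem isPosElt_iff_of_injective [StarModule ℂ R] (hS : HasFaithfulRep S) (f : R →⋆ₐ[ℂ] S)
    (hf : Function.Injective f) {a : R} : IsPosElt a ↔ IsPosElt (f a) := by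
  refine ⟨fun h => h.map f, fun h => ?_⟩
  obtain ⟨N, _, _, π, hπ⟩ := hS
  exact IsPosElt.of_posSemidef (π.comp f) (hπ.comp hf) (h.map π).posSemidef

end Representations

/-! ### The left regular representation. -/

section GroupAlgebra

variable (G : Type*) [Group G] [Fintype G] [DecidableEq G]

/-- The left regular representation of the group algebra by matrices. -/
noncomputable def regularRep : MonoidAlgebra ℂ G →⋆ₐ[ℂ] Matrix G G ℂ :=
  have key : ∀ x y : MonoidAlgebra ℂ G, ∀ h k : G, (x * y).coeff (h * k⁻¹) =
      ∑ l, x.coeff (h * l⁻¹) * y.coeff (l * k⁻¹) := fun x y h k => by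
    induction x using MonoidAlgebra.induction_linear with
    | zero => simp
    | add x₁ x₂ h₁ h₂ => simp [add_mul, Finset.sum_add_distrib, h₁, h₂]
    | single g c =>
      rw [MonoidAlgebra.coeff_single_mul_apply, Finset.sum_eq_single (g⁻¹ * h)]
      · simp [mul_assoc]
      · intro l _ hl
        have : g ≠ h * l⁻¹ := fun e => hl (by rw [e]; group)
        simp [MonoidAlgebra.coeff_single, this]
      · simp
  { toFun := fun x => Matrix.of fun h k => x.coeff (h * k⁻¹)
    map_one' := by
      ext h k
      simp [Matrix.one_apply, MonoidAlgebra.one_def, MonoidAlgebra.coeff_single,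
        Finsupp.single_apply, eq_comm, mul_inv_eq_one]
    map_mul' := fun x y => by
      ext h k
      simp [Matrix.mul_apply, key]
    map_zero' := by ext; simp
    map_add' := fun x y => by ext; simp
    commutes' := fun r => by
      ext h k
      simp [Matrix.algebraMap_matrix_apply, MonoidAlgebra.coeff_single,
        Finsupp.single_apply, eq_comm, mul_inv_eq_one]
    map_star' := fun x => by
      ext h k
      simp [Matrix.star_apply, coeff_groupAlgebra_star] }

theorem hasFaithfulRep_groupAlgebra (G : Type) [Group G] [Fintype G] [DecidableEq G] :
    HasFaithfulRep (MonoidAlgebra ℂ G) := by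
  refine ⟨G, _, _, regularRep G, fun x y hxy => ?_⟩
  ext g
  -- The column indexed by the neutral element lists the coefficients.
  simpa [regularRep] using congrFun (congrFun hxy g) 1

end GroupAlgebra

/-! ### Slice maps and convolution of functionals. -/

section Slices

variable {A : Type*} [Ring A] [Algebra ℂ A]

@[simp]
theorem sliceLeft_tmul (f : A →ₗ[ℂ] ℂ) (a b : A) : sliceLeft f (a ⊗ₜ[ℂ] b) = f a • b := rfl

@[simp]
theorem sliceRight_tmul (f : A →ₗ[ℂ] ℂ) (a b : A) : sliceRight f (a ⊗ₜ[ℂ] b) = f b • a := rfl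

@[simp]
theorem tensorFlip_tmul (a b : A) : tensorFlip A (a ⊗ₜ[ℂ] b) = b ⊗ₜ[ℂ] a := rfl

theorem apply_sliceRight (ξ η : A →ₗ[ℂ] ℂ) (t : A ⊗[ℂ] A) :
    ξ (sliceRight η t) = η (sliceLeft ξ t) := by
  induction t with
  | zero => simp
  | add x y hx hy => simp [hx, hy]
  | tmul a b => simp [mul_comm]

theorem sliceLeft_one_tmul_mul (ξ : A →ₗ[ℂ] ℂ) (d : A) (t : A ⊗[ℂ] A) :
    sliceLeft ξ ((1 ⊗ₜ d) * t) = d * sliceLeft ξ t := by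
  induction t with
  | zero => simp
  | add x y hx hy => simp [mul_add, hx, hy]
  | tmul a b => simp

theorem sliceLeft_mul_one_tmul (ξ : A →ₗ[ℂ] ℂ) (d : A) (t : A ⊗[ℂ] A) :
    sliceLeft ξ (t * (1 ⊗ₜ d)) = sliceLeft ξ t * d := by
  induction t with
  | zero => simp
  | add x y hx hy => simp [add_mul, hx, hy]
  | tmul a b => simp

theorem sliceLeft_rTensor (ξ : A →ₗ[ℂ] ℂ) (κ : A →ₗ[ℂ] A) (t : A ⊗[ℂ] A) :
    sliceLeft ξ (κ.rTensor A t) = sliceLeft (ξ ∘ₗ κ) t := by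
  induction t with
  | zero => simp
  | add x y hx hy => simp [hx, hy]
  | tmul a b => simp

theorem funConv_apply (Δ : A →ₗ[ℂ] A ⊗[ℂ] A) (ξ η : A →ₗ[ℂ] ℂ) (a : A) :
    funConv Δ ξ η a = η (sliceLeft ξ (Δ a)) := by
  simp only [funConv, LinearMap.comp_apply]
  induction Δ a with
  | zero => simp
  | add x y hx hy => simp [hx, hy]
  | tmul a b => simp

/-- With T_ξ = (ξ ⊗ id)Δ this reads T_{ξ·η} = T_η T_ξ. It is coassociativity after applying ξ ⊗ η ⊗
id, the map `F` below. -/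
theorem sliceLeft_funConv {Δ : A →ₗ[ℂ] A ⊗[ℂ] A} {ε : A →ₗ[ℂ] ℂ}
    (h : IsCoalgebraStructure Δ ε) (ξ η : A →ₗ[ℂ] ℂ) (a : A) :
    sliceLeft (funConv Δ ξ η) (Δ a) = sliceLeft η (Δ (sliceLeft ξ (Δ a))) := by
  let F : A ⊗[ℂ] (A ⊗[ℂ] A) →ₗ[ℂ] A :=
    sliceLeft η ∘ₗ (TensorProduct.lid ℂ (A ⊗[ℂ] A)).toLinearMap ∘ₗ ξ.rTensor (A ⊗[ℂ] A)
  have h₁ : ∀ t, F (TensorProduct.assoc ℂ A A A (Δ.rTensor A t)) =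
      sliceLeft (funConv Δ ξ η) t := fun t => by
    induction t with
    | zero => simp
    | add x y hx hy => simp only [map_add, hx, hy]
    | tmul x y =>
      rw [LinearMap.rTensor_tmul, sliceLeft_tmul, funConv_apply]
      induction Δ x with
      | zero => simp
      | add u v hu hv => simp only [TensorProduct.add_tmul, map_add, add_smul, hu, hv]
      | tmul u v => simp [F, mul_smul, smul_comm (ξ u)]
  have h₂ : ∀ t, F (Δ.lTensor A t) = sliceLeft η (Δ (sliceLeft ξ t)) := fun t => by
    induction t with
    | zero => simp
    | add x y hx hy => simp only [map_add, hx, hy]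
    | tmul x y => simp [F]
  rw [← h₁, h.coassoc, h₂]

end Slices

/-! ### Positive definite elements from Haar coefficients. -/

section PositiveDefinite

variable {A : Type*} [Ring A] [StarRing A] [Algebra ℂ A] [StarModule ℂ A]

theorem funInvol_apply (st : A →ₗ⋆[ℂ] A) (ξ : A →ₗ[ℂ] ℂ) (a : A) :
    funInvol st ξ a = star (ξ (st a)) := rfl

theorem sliceLeft_comp_star {ξ ξ' : A →ₗ[ℂ] ℂ} (h : ∀ a, ξ' a = star (ξ (star a)))
    (t : A ⊗[ℂ] A) : sliceLeft ξ' (star t) = star (sliceLeft ξ t) := by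
  induction t with
  | zero => simp
  | add x y hx hy => simp [hx, hy]
  | tmul a b => simp [h, star_smul]

/-- The coefficient `(id ⊗ μ) ((1 ⊗ d*) Δ c)`. -/
noncomputable def haarCoefficient (Δ : A →ₗ[ℂ] A ⊗[ℂ] A) (μ : A →ₗ[ℂ] ℂ) (c d : A) : A :=
  sliceRight μ ((1 ⊗ₜ[ℂ] star d) * Δ c)

theorem apply_haarCoefficient (Δ : A →ₗ[ℂ] A ⊗[ℂ] A) (μ ξ : A →ₗ[ℂ] ℂ) (c d : A) :
    ξ (haarCoefficient Δ μ c d) = μ (star d * sliceLeft ξ (Δ c)) := by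
  rw [haarCoefficient, apply_sliceRight, sliceLeft_one_tmul_mul]

/-- Write T_ξ = (ξ ⊗ id)Δ and ⟨x, y⟩ = μ(x* y). Strong invariance says that T_{ξ⁺} is the adjoint of
T_ξ, so ξ·ξ⁺ takes on this coefficient the value ⟨c, T_{ξ⁺} T_ξ c⟩ = ⟨T_ξ c, T_ξ c⟩. -/
theorem isPositiveDefinite_haarCoefficient {Δ : A →ₗ[ℂ] A ⊗[ℂ] A} {ε μ : A →ₗ[ℂ] ℂ}
    {st : A →ₗ⋆[ℂ] A} {κ : A →ₗ[ℂ] A} (hΔ : IsCoalgebraStructure Δ ε)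
    (hstar : ∀ a, Δ (star a) = star (Δ a)) (hst : ∀ a, st (st a) = a)
    (hstst : ∀ a, st (star a) = star (st a)) (hκ : ∀ a, κ a = star (st a)) (hμ : ∀ a, IsPosElt a → 0 ≤ μ a)
    (hinv : ∀ a b : A, sliceRight μ (κ.rTensor A (Δ a) * (1 ⊗ₜ[ℂ] b)) =
      sliceRight μ ((1 ⊗ₜ[ℂ] a) * Δ b)) (c : A) :
    IsPositiveDefinite Δ st (haarCoefficient Δ μ c c) := by
  intro ξ
  have adj : ∀ d, μ (star c * sliceLeft (funInvol st ξ) (Δ d)) =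
      μ (star (sliceLeft ξ (Δ c)) * d) := fun d => by
    rw [← sliceLeft_one_tmul_mul, ← apply_sliceRight, ← hinv, apply_sliceRight,
      sliceLeft_mul_one_tmul, sliceLeft_rTensor, hstar, sliceLeft_comp_star (ξ := ξ)]
    intro a
    simp only [LinearMap.comp_apply, funInvol_apply, hκ]
    -- Since κ = * ∘ ⋆, the functional ξ⁺ ∘ κ is a ↦ conj ξ(a*).
    rw [hstst, hst]
  rw [apply_haarCoefficient, sliceLeft_funConv hΔ, adj]
  exact hμ _ (isPosElt_star_mul_self _)

theorem haarCoefficient_polarization (Δ : A →ₗ[ℂ] A ⊗[ℂ] A) (μ : A →ₗ[ℂ] ℂ) (c d : A) :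
    haarCoefficient Δ μ c d = (1 / 4 : ℂ) • ∑ k : Fin 4, Complex.I ^ (k : ℕ) •
      haarCoefficient Δ μ (c + Complex.I ^ (k : ℕ) • d) (c + Complex.I ^ (k : ℕ) • d) := by
  have h3 : Complex.I ^ 3 = -Complex.I := by rw [pow_succ, Complex.I_sq]; ring
  simp only [haarCoefficient, Fin.sum_univ_four]
  simp [h3, TensorProduct.tmul_add, TensorProduct.tmul_smul, add_mul, mul_add, star_smul,
    smul_smul, TensorProduct.tmul_neg]
  module

/-- By polarization the span contains every coefficient. A functional ξ that kills it satisfies μ(d*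
T_ξ c) = 0 for all c and d; taking d = T_ξ c, faithfulness gives T_ξ c = 0, and the counit then
gives ξ(c) = 0. -/
theorem span_isPositiveDefinite_eq_top {Δ : A →ₗ[ℂ] A ⊗[ℂ] A} {ε μ : A →ₗ[ℂ] ℂ}
    {st : A →ₗ⋆[ℂ] A} {κ : A →ₗ[ℂ] A} (hΔ : IsCoalgebraStructure Δ ε)
    (hstar : ∀ a, Δ (star a) = star (Δ a)) (hst : ∀ a, st (st a) = a)
    (hstst : ∀ a, st (star a) = star (st a)) (hκ : ∀ a, κ a = star (st a)) (hμ : ∀ a, IsPosElt a → 0 ≤ μ a)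
    (hinv : ∀ a b : A, sliceRight μ (κ.rTensor A (Δ a) * (1 ⊗ₜ[ℂ] b)) =
      sliceRight μ ((1 ⊗ₜ[ℂ] a) * Δ b)) (hfaith : ∀ a : A, μ (star a * a) = 0 → a = 0) :
    Submodule.span ℂ {a | IsPositiveDefinite Δ st a} = ⊤ := by
  have hmem : ∀ c d, haarCoefficient Δ μ c d ∈
      Submodule.span ℂ {a | IsPositiveDefinite Δ st a} := fun c d => by
    rw [haarCoefficient_polarization]
    exact Submodule.smul_mem _ _ (Submodule.sum_mem _ fun k _ => Submodule.smul_mem _ _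
      (Submodule.subset_span
        (isPositiveDefinite_haarCoefficient hΔ hstar hst hstst hκ hμ hinv _)))
  by_contra hne
  obtain ⟨ξ, hξ, hker⟩ := Submodule.exists_le_ker_of_lt_top _ (lt_top_iff_ne_top.2 hne)
  refine hξ (LinearMap.ext fun c => ?_)
  have h0 : sliceLeft ξ (Δ c) = 0 := hfaith _ <| by
    rw [← apply_haarCoefficient]
    exact hker (hmem _ _)
  rw [← hΔ.counit_right c, apply_sliceRight, h0, map_zero, LinearMap.zero_apply]

end PositiveDefinite

/-! ### Positivity under averaging. -/

section Positivity

variable {R S : Type*} [Ring R] [StarRing R] [Algebra ℂ R] [Ring S] [StarRing S] [Algebra ℂ S]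

theorem IsPosElt.smul [StarModule ℂ R] {a : R} (ha : IsPosElt a) {c : ℝ} (hc : 0 ≤ c) :
    IsPosElt ((c : ℂ) • a) := by
  refine ha.induction (p := fun a => IsPosElt ((c : ℂ) • a)) (by simpa using isPosElt_zero)
    (fun x y hx hy => by simpa using hx.add hy) (fun s => ?_)
  have : (c : ℂ) • (star s * s) = star ((Real.sqrt c : ℂ) • s) * ((Real.sqrt c : ℂ) • s) := by
    rw [star_smul, smul_mul_smul_comm, Complex.star_def, Complex.conj_ofReal,
      ← Complex.ofReal_mul, Real.mul_self_sqrt hc]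
  rw [this]
  exact isPosElt_star_mul_self _

theorem IsPosElt.sum {I : Type*} (s : Finset I) {f : I → R} (hf : ∀ i ∈ s, IsPosElt (f i)) :
    IsPosElt (∑ i ∈ s, f i) :=
  AddSubmonoid.sum_mem _ hf

/-- Averaging over finitely many *-endomorphisms preserves positivity in a *-subalgebra. -/
theorem IsPosElt.of_average [StarModule ℂ R] [StarModule ℂ S] (hR : HasFaithfulRep R)
    (j : S →⋆ₐ[ℂ] R) (hj : Function.Injective j) {I : Type*} [Fintype I] (φ : I → R →⋆ₐ[ℂ] R)
    {c : ℝ} (hc : 0 ≤ c) {x : R} (hx : IsPosElt x) {y : S} (hy : j y = (c : ℂ) • ∑ i, φ i x) :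
    IsPosElt y := by
  rw [isPosElt_iff_of_injective hR j hj, hy]
  exact (IsPosElt.sum _ fun i _ => hx.map (φ i)).smul hc

end Positivity

/-! ### The Delsart construction for a finite group of automorphisms. -/

section Delsart

variable {A : Type*} [Ring A] [StarRing A] [Algebra ℂ A] [StarModule ℂ A]
variable (Γ : Subgroup (A ≃⋆ₐ[ℂ] A)) [Fintype Γ]

theorem coe_fixedExpectation (a : A) : (fixedExpectation Γ a : A) =
    (Fintype.card Γ : ℂ)⁻¹ • ∑ γ : Γ, (γ : A ≃⋆ₐ[ℂ] A) a := rfl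

theorem card_subgroup_ne_zero : (Fintype.card Γ : ℂ) ≠ 0 := by
  exact_mod_cast Fintype.card_ne_zero

@[simp]
theorem fixedInclusion_apply (b : fixedAlgebra Γ) : fixedInclusion Γ b = (b : A) := rfl

@[simp]
theorem fixedExpectation_coe (b : fixedAlgebra Γ) : fixedExpectation Γ (b : A) = b := by
  ext
  rw [coe_fixedExpectation, Finset.sum_congr rfl fun (γ : Γ) _ => b.2 γ γ.2, Finset.sum_const,
    Finset.card_univ, ← Nat.cast_smul_eq_nsmul ℂ, smul_smul,
    inv_mul_cancel₀ (card_subgroup_ne_zero Γ), one_smul]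

theorem fixedExpectation_apply_of_mem {γ : A ≃⋆ₐ[ℂ] A} (hγ : γ ∈ Γ) (a : A) :
    fixedExpectation Γ (γ a) = fixedExpectation Γ a := by
  ext
  rw [coe_fixedExpectation, coe_fixedExpectation]
  congr 1
  exact Fintype.sum_equiv (Equiv.mulRight (⟨γ, hγ⟩ : Γ)) _ _ fun _ => rfl

theorem fixedExpectation_mul_coe (a : A) (b : fixedAlgebra Γ) :
    fixedExpectation Γ (a * b) = fixedExpectation Γ a * b := by
  ext
  rw [MulMemClass.coe_mul, coe_fixedExpectation, coe_fixedExpectation, smul_mul_assoc,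
    Finset.sum_mul]
  congr 1
  exact Finset.sum_congr rfl fun γ _ => by rw [map_mul, b.2 γ γ.2]

theorem fixedExpectation_coe_mul (a : A) (b : fixedAlgebra Γ) :
    fixedExpectation Γ (b * a) = b * fixedExpectation Γ a := by
  ext
  rw [MulMemClass.coe_mul, coe_fixedExpectation, coe_fixedExpectation, mul_smul_comm,
    Finset.mul_sum]
  congr 1
  exact Finset.sum_congr rfl fun γ _ => by rw [map_mul, b.2 γ γ.2]

theorem fixedExpectation_one : fixedExpectation Γ 1 = 1 :=
  fixedExpectation_coe Γ 1

theorem fixedExpectation_star (a : A) :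
    fixedExpectation Γ (star a) = star (fixedExpectation Γ a) := by
  ext
  rw [StarMemClass.coe_star, coe_fixedExpectation, coe_fixedExpectation, star_smul, star_sum]
  simp [map_star]

theorem apply_coe_fixedExpectation {f : A →ₗ[ℂ] ℂ} (hf : ∀ γ ∈ Γ, ∀ a, f (γ a) = f a) (a : A) :
    f (fixedExpectation Γ a) = f a := by
  rw [coe_fixedExpectation, map_smul, map_sum, Finset.sum_congr rfl fun (γ : Γ) _ => hf γ γ.2 a,
    Finset.sum_const, Finset.card_univ, ← Nat.cast_smul_eq_nsmul ℂ, smul_smul,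
    inv_mul_cancel₀ (card_subgroup_ne_zero Γ), one_smul]

theorem coe_fixedExpectation_apply {κ : A →ₗ[ℂ] A} (hκ : ∀ γ ∈ Γ, ∀ a, γ (κ a) = κ (γ a))
    (a : A) : (fixedExpectation Γ (κ a) : A) = κ (fixedExpectation Γ a) := by
  rw [coe_fixedExpectation, coe_fixedExpectation, map_smul, map_sum]
  congr 1
  exact Finset.sum_congr rfl fun γ _ => hκ γ γ.2 a

theorem delsartComul_apply (Δ : A →ₗ[ℂ] A ⊗[ℂ] A) (b : fixedAlgebra Γ) :
    delsartComul Γ Δ b =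
      TensorProduct.map (fixedExpectation Γ) (fixedExpectation Γ) (Δ b) := rfl

/-- The conditional expectation, with values in the whole algebra. -/
noncomputable def fixedProjection : A →ₗ[ℂ] A := fixedInclusion Γ ∘ₗ fixedExpectation Γ

theorem rTensor_fixedProjection (t : A ⊗[ℂ] A) : (fixedProjection Γ).rTensor A t =
    (Fintype.card Γ : ℂ)⁻¹ • ∑ γ : Γ, (γ : A ≃⋆ₐ[ℂ] A).toAlgEquiv.toLinearMap.rTensor A t := by
  induction t with
  | zero => simp
  | add x y hx hy => simp only [map_add, hx, hy, Finset.sum_add_distrib, smul_add]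
  | tmul x y =>
    simp [fixedProjection, coe_fixedExpectation, TensorProduct.sum_tmul, ← TensorProduct.smul_tmul']

theorem lTensor_fixedProjection (t : A ⊗[ℂ] A) : (fixedProjection Γ).lTensor A t =
    (Fintype.card Γ : ℂ)⁻¹ • ∑ γ : Γ, (γ : A ≃⋆ₐ[ℂ] A).toAlgEquiv.toLinearMap.lTensor A t := by
  induction t with
  | zero => simp
  | add x y hx hy => simp only [map_add, hx, hy, Finset.sum_add_distrib, smul_add]
  | tmul x y =>
    simp [fixedProjection, coe_fixedExpectation, TensorProduct.tmul_sum]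

variable {Γ}

/-- For fixed b the element Δ(b) is invariant under γ⁻¹ ⊗ γ⁻¹, so (γ ⊗ id)Δ(b) = (id ⊗ γ⁻¹)Δ(b).
Summing over Γ, which inversion permutes, moves the average from one leg to the other. -/
theorem rTensor_fixedProjection_comul {Δ : A →ₗ[ℂ] A ⊗[ℂ] A}
    (hΓ : ∀ γ ∈ Γ, ∀ a, Δ (γ a) = TensorProduct.map
      (γ.toAlgEquiv.toLinearMap) (γ.toAlgEquiv.toLinearMap) (Δ a)) (b : fixedAlgebra Γ) :
    (fixedProjection Γ).rTensor A (Δ b) = (fixedProjection Γ).lTensor A (Δ b) := by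
  rw [rTensor_fixedProjection, lTensor_fixedProjection]
  congr 1
  refine Fintype.sum_equiv (Equiv.inv Γ) _ _ fun γ => ?_
  have h := hΓ _ (γ⁻¹).2 b
  rw [b.2 _ (γ⁻¹).2] at h
  conv_lhs => rw [h]
  generalize Δ b = t
  induction t with
  | zero => simp
  | add x y hx hy => simp only [map_add, hx, hy]
  | tmul x y =>
    have hc : (γ : A ≃⋆ₐ[ℂ] A) ((γ⁻¹ : A ≃⋆ₐ[ℂ] A) x) = x := by
      rw [← StarAlgEquiv.mul_apply, mul_inv_cancel, StarAlgEquiv.one_apply]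
    simp [hc]

/-- Each iterated comultiplication carries an extra projection on the leg that is split again. That
projection moves to the other leg, where the outer expectation absorbs it, and what remains is
coassociativity of `Δ`. -/
theorem IsCoalgebraStructure.delsart {Δ : A →ₗ[ℂ] A ⊗[ℂ] A} {ε : A →ₗ[ℂ] ℂ}
    (h : IsCoalgebraStructure Δ ε)
    (hΓ : ∀ γ ∈ Γ, ∀ a, Δ (γ a) = TensorProduct.map
      (γ.toAlgEquiv.toLinearMap) (γ.toAlgEquiv.toLinearMap) (Δ a))
    (hε : ∀ γ ∈ Γ, ∀ a, ε (γ a) = ε a) :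
    IsCoalgebraStructure (delsartComul Γ Δ) (ε ∘ₗ fixedInclusion Γ) where
  coassoc b := by
    set E := fixedExpectation Γ
    have h₁ : ∀ t : A ⊗[ℂ] A, (delsartComul Γ Δ).rTensor _ (TensorProduct.map E E t) =
        TensorProduct.map (TensorProduct.map E E) E
          (Δ.rTensor A ((fixedProjection Γ).rTensor A t)) := fun t => by
      induction t with
      | zero => simp
      | add x y hx hy => simp only [map_add, hx, hy]
      | tmul x y => simp [fixedProjection, delsartComul_apply, E]
    have h₂ : ∀ t : A ⊗[ℂ] A, (delsartComul Γ Δ).lTensor _ (TensorProduct.map E E t) =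
        TensorProduct.map E (TensorProduct.map E E)
          (Δ.lTensor A ((fixedProjection Γ).lTensor A t)) := fun t => by
      induction t with
      | zero => simp
      | add x y hx hy => simp only [map_add, hx, hy]
      | tmul x y => simp [fixedProjection, delsartComul_apply, E]
    have h₃ : ∀ t : A ⊗[ℂ] A, TensorProduct.map (TensorProduct.map E E) E
          (Δ.rTensor A ((fixedProjection Γ).lTensor A t)) =
        TensorProduct.map (TensorProduct.map E E) E (Δ.rTensor A t) := fun t => by
      induction t with
      | zero => simp
      | add x y hx hy => simp only [map_add, hx, hy]
      | tmul x y => simp [fixedProjection, E]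
    have h₄ : ∀ t : A ⊗[ℂ] A, TensorProduct.map E (TensorProduct.map E E)
          (Δ.lTensor A ((fixedProjection Γ).rTensor A t)) =
        TensorProduct.map E (TensorProduct.map E E) (Δ.lTensor A t) := fun t => by
      induction t with
      | zero => simp
      | add x y hx hy => simp only [map_add, hx, hy]
      | tmul x y => simp [fixedProjection, E]
    rw [delsartComul_apply, h₁, h₂, rTensor_fixedProjection_comul hΓ, h₃,
      ← rTensor_fixedProjection_comul hΓ, h₄, ← h.coassoc, TensorProduct.map_map_assoc]
  counit_left b := by
    have key : ∀ t : A ⊗[ℂ] A, sliceLeft (ε ∘ₗ fixedInclusion Γ)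
        (TensorProduct.map (fixedExpectation Γ) (fixedExpectation Γ) t) =
        fixedExpectation Γ (sliceLeft ε t) := fun t => by
      induction t with
      | zero => simp
      | add x y hx hy => simp only [map_add, hx, hy]
      | tmul x y => simp [apply_coe_fixedExpectation Γ hε]
    rw [delsartComul_apply, key, h.counit_left, fixedExpectation_coe]
  counit_right b := by
    have key : ∀ t : A ⊗[ℂ] A, sliceRight (ε ∘ₗ fixedInclusion Γ)
        (TensorProduct.map (fixedExpectation Γ) (fixedExpectation Γ) t) =
        fixedExpectation Γ (sliceRight ε t) := fun t => by
      induction t with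
      | zero => simp
      | add x y hx hy => simp only [map_add, hx, hy]
      | tmul x y => simp [apply_coe_fixedExpectation Γ hε]
    rw [delsartComul_apply, key, h.counit_right, fixedExpectation_coe]

/-- Uniqueness of the Haar state: ν = μ ∘ γ is left invariant and normalized, and evaluating (ν ⊗
μ)Δ(a) by slicing either leg first gives ν(a) = μ(a). -/
theorem IsHaarState.apply_automorphism {Δ : A →ₗ[ℂ] A ⊗[ℂ] A} {μ : A →ₗ[ℂ] ℂ}
    (h : IsHaarState Δ μ) {γ : A ≃⋆ₐ[ℂ] A} (hγ : ∀ a, Δ (γ a) = TensorProduct.map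
      (γ.toAlgEquiv.toLinearMap) (γ.toAlgEquiv.toLinearMap) (Δ a)) (a : A) :
    μ (γ a) = μ a := by
  let ν : A →ₗ[ℂ] ℂ := μ ∘ₗ γ.toAlgEquiv.toLinearMap
  have key : ∀ t : A ⊗[ℂ] A, γ (sliceLeft ν t) = sliceLeft μ (TensorProduct.map
      (γ.toAlgEquiv.toLinearMap) (γ.toAlgEquiv.toLinearMap) t) := fun t => by
    induction t with
    | zero => simp
    | add x y hx hy => simp only [map_add, hx, hy]
    | tmul x y => simp [ν]
  have hν : sliceLeft ν (Δ a) = ν a • 1 := EquivLike.injective γ <| by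
    have h1 : γ 1 = 1 := _root_.map_one γ
    rw [key, ← hγ, h.left_inv, map_smul, h1]
    rfl
  have := apply_sliceRight ν μ (Δ a)
  rw [hν, h.right_inv, map_smul, map_smul, h.map_one] at this
  have h1 : ν 1 = 1 := by simp [ν, h.map_one]
  rw [h1] at this
  simpa [ν] using this.symm

theorem IsHaarState.delsart {Δ : A →ₗ[ℂ] A ⊗[ℂ] A} {μ : A →ₗ[ℂ] ℂ}
    (h : IsHaarState Δ μ) (hΓ : ∀ γ ∈ Γ, ∀ a, Δ (γ a) = TensorProduct.map
      (γ.toAlgEquiv.toLinearMap) (γ.toAlgEquiv.toLinearMap) (Δ a)) :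
    IsHaarState (delsartComul Γ Δ) (μ ∘ₗ fixedInclusion Γ) := by
  have hμ : ∀ γ ∈ Γ, ∀ a, μ (γ a) = μ a := fun γ hγ => h.apply_automorphism (hΓ γ hγ)
  refine ⟨h.map_one, fun a ha => h.nonneg _ (ha.map (fixedAlgebra Γ).subtype), fun b => ?_,
    fun b => ?_⟩
  · have key : ∀ t : A ⊗[ℂ] A, sliceLeft (μ ∘ₗ fixedInclusion Γ)
        (TensorProduct.map (fixedExpectation Γ) (fixedExpectation Γ) t) =
        fixedExpectation Γ (sliceLeft μ t) := fun t => by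
      induction t with
      | zero => simp
      | add x y hx hy => simp only [map_add, hx, hy]
      | tmul x y => simp [apply_coe_fixedExpectation Γ hμ]
    rw [delsartComul_apply, key, h.left_inv, map_smul, fixedExpectation_one]
    rfl
  · have key : ∀ t : A ⊗[ℂ] A, sliceRight (μ ∘ₗ fixedInclusion Γ)
        (TensorProduct.map (fixedExpectation Γ) (fixedExpectation Γ) t) =
        fixedExpectation Γ (sliceRight μ t) := fun t => by
      induction t with
      | zero => simp
      | add x y hx hy => simp only [map_add, hx, hy]
      | tmul x y => simp [apply_coe_fixedExpectation Γ hμ]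
    rw [delsartComul_apply, key, h.right_inv, map_smul, fixedExpectation_one]
    rfl

/-- The comultiplication of a Kac algebra as a *-homomorphism. -/
noncomputable def IsKacAlgebra.comulHom {Δ : A →ₗ[ℂ] A ⊗[ℂ] A} {ε : A →ₗ[ℂ] ℂ}
    {κ : A →ₗ[ℂ] A} {μ : A →ₗ[ℂ] ℂ} (h : IsKacAlgebra Δ ε κ μ) : A →⋆ₐ[ℂ] A ⊗[ℂ] A where
  __ := AlgHom.ofLinearMap Δ h.comul_one h.comul_mul
  map_star' := h.comul_star

/-- Seen in A ⊗ A, the map P ⊗ P is a nonnegative multiple of a sum of *-homomorphisms γ ⊗ δ. This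
is the source of its complete positivity. -/
theorem coe_map_fixedExpectation (t : A ⊗[ℂ] A) :
    tensorStarHom (fixedAlgebra Γ).subtype (fixedAlgebra Γ).subtype
      (TensorProduct.map (fixedExpectation Γ) (fixedExpectation Γ) t) =
    ((((Fintype.card Γ : ℝ)⁻¹ * (Fintype.card Γ : ℝ)⁻¹ : ℝ)) : ℂ) • ∑ p : Γ × Γ,
      tensorStarHom ((p.1 : A ≃⋆ₐ[ℂ] A) : A →⋆ₐ[ℂ] A) ((p.2 : A ≃⋆ₐ[ℂ] A) : A →⋆ₐ[ℂ] A) t := by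
  induction t with
  | zero => simp
  | add x y hx hy => simp only [map_add, hx, hy, Finset.sum_add_distrib, smul_add]
  | tmul x y =>
    change (fixedExpectation Γ x : A) ⊗ₜ[ℂ] (fixedExpectation Γ y : A) =
      _ • ∑ p : Γ × Γ, (p.1 : A ≃⋆ₐ[ℂ] A) x ⊗ₜ[ℂ] (p.2 : A ≃⋆ₐ[ℂ] A) y
    rw [coe_fixedExpectation, coe_fixedExpectation, TensorProduct.smul_tmul_smul,
      TensorProduct.sum_tmul, Fintype.sum_prod_type]
    simp only [TensorProduct.tmul_sum]
    simp

theorem tensorStarHom_subtype_injective : Function.Injective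
    (tensorStarHom (fixedAlgebra Γ).subtype (fixedAlgebra Γ).subtype) :=
  TensorProduct.map_injective_of_flat_flat _ _ Subtype.val_injective Subtype.val_injective

theorem IsPosElt.map_fixedExpectation (hA : HasFaithfulRep A) {t : A ⊗[ℂ] A} (ht : IsPosElt t) :
    IsPosElt (TensorProduct.map (fixedExpectation Γ) (fixedExpectation Γ) t) :=
  .of_average (hA.tensor hA) _ tensorStarHom_subtype_injective _ (by positivity) ht
    (coe_map_fixedExpectation t)

theorem IsPosElt.matrix_map_fixedExpectation (hA : HasFaithfulRep A) {k : ℕ}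
    {X : Matrix (Fin k) (Fin k) (A ⊗[ℂ] A)} (hX : IsPosElt X) :
    IsPosElt (X.map (TensorProduct.map (fixedExpectation Γ) (fixedExpectation Γ))) := by
  refine .of_average (hA.tensor hA).matrix
    (matrixStarHom (tensorStarHom (fixedAlgebra Γ).subtype (fixedAlgebra Γ).subtype)) ?_
    (fun p : Γ × Γ => matrixStarHom (tensorStarHom ((p.1 : A ≃⋆ₐ[ℂ] A) : A →⋆ₐ[ℂ] A)
      ((p.2 : A ≃⋆ₐ[ℂ] A) : A →⋆ₐ[ℂ] A)))
    (c := (Fintype.card Γ : ℝ)⁻¹ * (Fintype.card Γ : ℝ)⁻¹) (by positivity) hX ?_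
  · intro x y hxy
    ext i j
    exact tensorStarHom_subtype_injective (congrFun (congrFun hxy i) j)
  · ext i j
    rw [Matrix.smul_apply, Matrix.sum_apply]
    exact coe_map_fixedExpectation (X i j)

theorem tensorFlip_comul_starAntipode {Δ : A →ₗ[ℂ] A ⊗[ℂ] A} {ε : A →ₗ[ℂ] ℂ}
    {κ : A →ₗ[ℂ] A} {μ : A →ₗ[ℂ] ℂ} (h : IsKacAlgebra Δ ε κ μ) {st : A →ₗ⋆[ℂ] A}
    (hst : ∀ a, st a = star (κ a)) (a : A) :
    Δ (st a) = tensorFlip A (TensorProduct.map st st (Δ a)) := by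
  rw [hst, h.comul_star, h.comul_antipode]
  induction Δ a with
  | zero => simp
  | add x y hx hy => simp only [map_add, star_add, hx, hy]
  | tmul x y => simp [hst]

/-- The expectation intertwines the structure maps of A with those of the fixed algebra, so the
algebraic axioms descend from the Kac algebra. The positivity axioms use the faithful
representation. -/
theorem IsKacAlgebra.isDelsartHypergroup {Δ : A →ₗ[ℂ] A ⊗[ℂ] A} {ε : A →ₗ[ℂ] ℂ}
    {κ : A →ₗ[ℂ] A} {μ : A →ₗ[ℂ] ℂ} (h : IsKacAlgebra Δ ε κ μ) (hA : HasFaithfulRep A)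
    (hΓ : ∀ γ ∈ Γ, IsKacAutomorphism Δ ε κ γ) : IsDelsartHypergroup Γ Δ ε κ μ := by
  have hκ : ∀ γ ∈ Γ, ∀ a, γ (κ a) = κ (γ a) := fun γ hγ => (hΓ γ hγ).antipode
  have hΔ : ∀ γ ∈ Γ, ∀ a, Δ (γ a) = TensorProduct.map
      (γ.toAlgEquiv.toLinearMap) (γ.toAlgEquiv.toLinearMap) (Δ a) := fun γ hγ => (hΓ γ hγ).comul
  have hε : ∀ γ ∈ Γ, ∀ a, ε (γ a) = ε a := fun γ hγ => (hΓ γ hγ).counit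
  have hμ : ∀ γ ∈ Γ, ∀ a, μ (γ a) = μ a := fun γ hγ => h.haar.apply_automorphism (hΔ γ hγ)
  let stA : A →ₗ⋆[ℂ] A := (starLinearEquiv ℂ (A := A)).toLinearMap.comp κ
  let st := delsartStar Γ κ
  have hst_apply : ∀ b : fixedAlgebra Γ, st b = fixedExpectation Γ (star (κ b)) := fun b => rfl
  have hst : ∀ b, (st b : A) = star (κ b) := fun b => by
    rw [hst_apply, fixedExpectation_star, StarMemClass.coe_star, coe_fixedExpectation_apply Γ hκ,
      fixedExpectation_coe]
  have hstE : ∀ a, st (fixedExpectation Γ a) = fixedExpectation Γ (stA a) := fun a => by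
    ext
    rw [hst, ← coe_fixedExpectation_apply Γ hκ, ← StarMemClass.coe_star, ← fixedExpectation_star]
    rfl
  have hst_st : ∀ b, st (st b) = b := fun b => by
    ext
    rw [hst, hst, h.antipode_star, star_star, h.antipode_antipode]
  have hst_star : ∀ b, st (star b) = star (st b) := fun b => by
    ext
    rw [StarMemClass.coe_star, hst, hst, StarMemClass.coe_star, h.antipode_star]
  have hcoalg := h.toIsCoalgebraStructure.delsart hΔ hε
  have hhaar := h.haar.delsart hΔ
  have hcomul_star : ∀ b, delsartComul Γ Δ (star b) = star (delsartComul Γ Δ b) := fun b => by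
    rw [delsartComul_apply, delsartComul_apply, StarMemClass.coe_star, h.comul_star]
    induction Δ b with
    | zero => simp
    | add x y hx hy => simp only [map_add, star_add, hx, hy]
    | tmul x y => simp [fixedExpectation_star]
  have hantipode : ∀ a, antipodeOf st 1 (fixedExpectation Γ a) = fixedExpectation Γ (κ a) :=
    fun a => by
      change star (st (fixedExpectation Γ a)) = _
      rw [hstE, ← fixedExpectation_star]
      exact congrArg _ (star_star (κ a))
  have hinv : ∀ a b : fixedAlgebra Γ, sliceRight (μ ∘ₗ fixedInclusion Γ)
      ((antipodeOf st 1).rTensor _ (delsartComul Γ Δ a) * (1 ⊗ₜ[ℂ] b)) =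
      sliceRight (μ ∘ₗ fixedInclusion Γ) ((1 ⊗ₜ[ℂ] a) * delsartComul Γ Δ b) := fun a b => by
    have h₁ : ∀ t : A ⊗[ℂ] A, sliceRight (μ ∘ₗ fixedInclusion Γ)
        ((antipodeOf st 1).rTensor _ (TensorProduct.map (fixedExpectation Γ)
          (fixedExpectation Γ) t) * (1 ⊗ₜ[ℂ] b)) =
        fixedExpectation Γ (sliceRight μ (κ.rTensor A t * (1 ⊗ₜ[ℂ] (b : A)))) := fun t => by
      induction t with
      | zero => simp
      | add x y hx hy => simp only [map_add, add_mul, hx, hy]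
      | tmul x y =>
        -- As b is fixed, μ(P(y) b) = μ(P(y b)) = μ(y b), so the projection on the integrated leg
        -- disappears.
        have := apply_coe_fixedExpectation Γ hμ (y * b)
        rw [fixedExpectation_mul_coe, MulMemClass.coe_mul] at this
        simp [hantipode, this]
    have h₂ : ∀ t : A ⊗[ℂ] A, sliceRight (μ ∘ₗ fixedInclusion Γ)
        ((1 ⊗ₜ[ℂ] a) * TensorProduct.map (fixedExpectation Γ) (fixedExpectation Γ) t) =
        fixedExpectation Γ (sliceRight μ ((1 ⊗ₜ[ℂ] (a : A)) * t)) := fun t => by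
      induction t with
      | zero => simp
      | add x y hx hy => simp only [map_add, mul_add, hx, hy]
      | tmul x y =>
        have := apply_coe_fixedExpectation Γ hμ (a * y)
        rw [fixedExpectation_coe_mul, MulMemClass.coe_mul] at this
        simp [this]
    rw [delsartComul_apply, delsartComul_apply, h₁, h₂, h.strong_inv]
  have hfaith : ∀ b : fixedAlgebra Γ, (μ ∘ₗ fixedInclusion Γ) (star b * b) = 0 → b = 0 :=
    fun b hb => Subtype.ext (h.haar_faithful _ hb)
  refine ⟨h, hΓ, hst, ?_⟩
  exact
  { hcoalg with
    comul_st := fun b => by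
      rw [delsartComul_apply, hst]
      have := tensorFlip_comul_starAntipode h (st := stA) (fun _ => rfl) b
      change Δ (star (κ b)) = _ at this
      rw [this, delsartComul_apply]
      induction Δ b with
      | zero => simp
      | add x y hx hy => simp only [map_add, hx, hy]
      | tmul x y => simp [← hstE, st]
    st_st := hst_st
    comul_pos := fun b hb =>
      ((hb.map (fixedAlgebra Γ).subtype).map h.comulHom).map_fixedExpectation hA
    st_mul := fun a b => by
      ext
      rw [MulMemClass.coe_mul, hst, hst, hst, MulMemClass.coe_mul, h.antipode_mul, star_mul]
    comul_star := hcomul_star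
    counit_mul := fun a b => h.counit_mul a b
    comul_one := by
      rw [delsartComul_apply, OneMemClass.coe_one, h.comul_one, Algebra.TensorProduct.one_def,
        TensorProduct.map_tmul, fixedExpectation_one]
      rfl
    st_star := hst_star
    cstar := (hA.of_injective (fixedAlgebra Γ).subtype Subtype.val_injective).isFinDimCStarAlgebra
    completelyPositive := fun k X hX =>
      ((hX.map (matrixStarHom (fixedAlgebra Γ).subtype)).map
        (matrixStarHom h.comulHom)).matrix_map_fixedExpectation hA
    span_posDef := span_isPositiveDefinite_eq_top hcoalg hcomul_star hst_st hst_star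
      (fun _ => rfl) hhaar.nonneg hinv hfaith
    sigma_add := fun _ _ => rfl
    sigma_star := fun _ _ => rfl
    sigma_entire := fun _ _ => differentiable_const _
    comul_sigma := fun _ b => by
      have : (1 : fixedAlgebra Γ ≃ₐ[ℂ] fixedAlgebra Γ).toLinearMap = LinearMap.id := rfl
      rw [this, TensorProduct.map_id]
      rfl
    haar_sigma := fun _ _ => rfl
    haar := hhaar
    -- The one-parameter group is trivial, so any parameter would serve.
    strong_inv := ⟨0, hinv⟩
    haar_faithful := hfaith }

end Delsart

/-! ### Strong invariance of the Haar measure. -/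

section StrongInvariance

variable {A : Type*} [Ring A] [Algebra ℂ A]

theorem sliceRight_tmul_mul (μ : A →ₗ[ℂ] ℂ) (c d : A) (t : A ⊗[ℂ] A) :
    sliceRight μ ((c ⊗ₜ[ℂ] d) * t) = c * sliceRight μ ((1 ⊗ₜ[ℂ] d) * t) := by
  induction t with
  | zero => simp
  | add x y hx hy => simp only [mul_add, map_add, hx, hy]
  | tmul x y => simp

/-- The strong invariance of the Haar measure follows from the invariance and the antipode law. -/
theorem strong_invariance {Δ : A →ₗ[ℂ] A ⊗[ℂ] A} {ε μ : A →ₗ[ℂ] ℂ} {κ : A →ₗ[ℂ] A}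
    (hΔ : IsCoalgebraStructure Δ ε) (hmul : ∀ a b, Δ (a * b) = Δ a * Δ b)
    (hκ : ∀ a, LinearMap.mul' ℂ A (κ.rTensor A (Δ a)) = algebraMap ℂ A (ε a))
    (hμ : ∀ a, sliceRight μ (Δ a) = μ a • (1 : A)) (a b : A) :
    sliceRight μ (κ.rTensor A (Δ a) * (1 ⊗ₜ[ℂ] b)) = sliceRight μ ((1 ⊗ₜ[ℂ] a) * Δ b) := by
  -- `F` sends x ⊗ t to x · (id ⊗ μ)(t Δ(b)). It is evaluated on the twofold comultiplication of a
  -- with κ on the first leg. Bracketing on the right, multiplicativity and invariance give the left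
  -- side; bracketing on the left, the antipode law gives the right side.
  let F : A ⊗[ℂ] (A ⊗[ℂ] A) →ₗ[ℂ] A :=
    LinearMap.mul' ℂ A ∘ₗ (sliceRight μ ∘ₗ LinearMap.mulRight ℂ (Δ b)).lTensor A
  have h₁ : ∀ s : A ⊗[ℂ] A, F (κ.rTensor _ (Δ.lTensor A s)) =
      sliceRight μ (κ.rTensor A s * (1 ⊗ₜ[ℂ] b)) := fun s => by
    induction s with
    | zero => simp
    | add x y hx hy => simp only [map_add, add_mul, hx, hy]
    | tmul x y => simp [F, ← hmul, hμ]
  have h₂ : ∀ s : A ⊗[ℂ] A, F (κ.rTensor _ (TensorProduct.assoc ℂ A A A (Δ.rTensor A s))) =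
      sliceRight μ ((1 ⊗ₜ[ℂ] sliceLeft ε s) * Δ b) := fun s => by
    induction s with
    | zero => simp
    | add x y hx hy => simp only [map_add, TensorProduct.tmul_add, add_mul, hx, hy]
    | tmul x y =>
      have : ∀ t : A ⊗[ℂ] A, F (κ.rTensor _ (TensorProduct.assoc ℂ A A A (t ⊗ₜ[ℂ] y))) =
          LinearMap.mul' ℂ A (κ.rTensor A t) * sliceRight μ ((1 ⊗ₜ[ℂ] y) * Δ b) := fun t => by
        induction t with
        | zero => simp
        | add x y hx hy => simp only [map_add, TensorProduct.add_tmul, add_mul, hx, hy]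
        | tmul u v => simp [F, sliceRight_tmul_mul μ v y, mul_assoc]
      rw [LinearMap.rTensor_tmul, this, hκ, sliceLeft_tmul, TensorProduct.tmul_smul,
        smul_mul_assoc, map_smul, Algebra.smul_def]
  rw [← h₁, ← hΔ.coassoc, h₂, hΔ.counit_left]

end StrongInvariance

/-! ### Twisting a bialgebra by a unitary 2-cocycle. -/

section Twisting

variable {A : Type*} [Ring A] [StarRing A] [Bialgebra ℂ A] [StarModule ℂ A]

theorem twistComul_apply (Ω : A ⊗[ℂ] A) (a : A) :
    twistComul Coalgebra.comul Ω a = Ω * Coalgebra.comul (R := ℂ) a * star Ω := by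
  simp [twistComul, mul_assoc]

theorem twistComul_one {Ω : A ⊗[ℂ] A} (hΩ : Ω ∈ unitary (A ⊗[ℂ] A)) :
    twistComul Coalgebra.comul Ω 1 = 1 := by
  rw [twistComul_apply, Bialgebra.comul_one, mul_one, Unitary.mul_star_self_of_mem hΩ]

theorem twistComul_mul {Ω : A ⊗[ℂ] A} (hΩ : Ω ∈ unitary (A ⊗[ℂ] A)) (a b : A) :
    twistComul Coalgebra.comul Ω (a * b) =
      twistComul Coalgebra.comul Ω a * twistComul Coalgebra.comul Ω b := by
  simp only [twistComul_apply, Bialgebra.comul_mul, mul_assoc]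
  rw [← mul_assoc (star Ω) Ω, Unitary.star_mul_self_of_mem hΩ, one_mul]

theorem twistComul_star (hA : ∀ a : A, Coalgebra.comul (R := ℂ) (star a) =
    star (Coalgebra.comul (R := ℂ) a)) (Ω : A ⊗[ℂ] A) (a : A) :
    twistComul Coalgebra.comul Ω (star a) = star (twistComul Coalgebra.comul Ω a) := by
  simp only [twistComul_apply, hA, star_mul, star_star, mul_assoc]

theorem sliceLeft_counit_mul (s t : A ⊗[ℂ] A) : sliceLeft (Coalgebra.counit (R := ℂ)) (s * t) =
    sliceLeft Coalgebra.counit s * sliceLeft Coalgebra.counit t := by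
  induction s with
  | zero => simp
  | add x y hx hy => simp only [map_add, add_mul, hx, hy]
  | tmul x y =>
    induction t with
    | zero => simp
    | add x y hx hy => simp only [map_add, mul_add, hx, hy]
    | tmul u v => simp [smul_smul, mul_comm]

theorem sliceRight_counit_mul (s t : A ⊗[ℂ] A) : sliceRight (Coalgebra.counit (R := ℂ)) (s * t) =
    sliceRight Coalgebra.counit s * sliceRight Coalgebra.counit t := by
  induction s with
  | zero => simp
  | add x y hx hy => simp only [map_add, add_mul, hx, hy]
  | tmul x y =>
    induction t with
    | zero => simp
    | add x y hx hy => simp only [map_add, mul_add, hx, hy]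
    | tmul u v => simp [smul_smul, mul_comm]

theorem comul_rTensor_mul (s t : A ⊗[ℂ] A) :
    (Coalgebra.comul (R := ℂ)).rTensor A (s * t) =
      (Coalgebra.comul (R := ℂ)).rTensor A s * (Coalgebra.comul (R := ℂ)).rTensor A t :=
  map_mul (Algebra.TensorProduct.map (Bialgebra.comulAlgHom ℂ A) (AlgHom.id ℂ A)) s t

theorem comul_lTensor_mul (s t : A ⊗[ℂ] A) :
    (Coalgebra.comul (R := ℂ)).lTensor A (s * t) =
      (Coalgebra.comul (R := ℂ)).lTensor A s * (Coalgebra.comul (R := ℂ)).lTensor A t :=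
  map_mul (Algebra.TensorProduct.map (AlgHom.id ℂ A) (Bialgebra.comulAlgHom ℂ A)) s t

theorem comul_rTensor_star (hA : ∀ a : A, Coalgebra.comul (R := ℂ) (star a) =
    star (Coalgebra.comul (R := ℂ) a)) (t : A ⊗[ℂ] A) :
    (Coalgebra.comul (R := ℂ)).rTensor A (star t) =
      star ((Coalgebra.comul (R := ℂ)).rTensor A t) := by
  induction t with
  | zero => simp
  | add x y hx hy => simp only [map_add, star_add, hx, hy]
  | tmul x y => simp [hA]

theorem comul_lTensor_star (hA : ∀ a : A, Coalgebra.comul (R := ℂ) (star a) =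
    star (Coalgebra.comul (R := ℂ) a)) (t : A ⊗[ℂ] A) :
    (Coalgebra.comul (R := ℂ)).lTensor A (star t) =
      star ((Coalgebra.comul (R := ℂ)).lTensor A t) := by
  induction t with
  | zero => simp
  | add x y hx hy => simp only [map_add, star_add, hx, hy]
  | tmul x y => simp [hA]

theorem assoc_tensor_mul (s t : (A ⊗[ℂ] A) ⊗[ℂ] A) : TensorProduct.assoc ℂ A A A (s * t) =
    TensorProduct.assoc ℂ A A A s * TensorProduct.assoc ℂ A A A t :=
  map_mul (Algebra.TensorProduct.assoc ℂ ℂ ℂ A A A) s t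

theorem assoc_tensor_star (t : (A ⊗[ℂ] A) ⊗[ℂ] A) : TensorProduct.assoc ℂ A A A (star t) =
    star (TensorProduct.assoc ℂ A A A t) := by
  induction t with
  | zero => simp
  | add x y hx hy => simp only [map_add, star_add, hx, hy]
  | tmul x y =>
    induction x with
    | zero => simp
    | add x y hx hy => simp_all only [map_add, star_add, TensorProduct.add_tmul]
    | tmul u v => simp

theorem IsCounitalTwoCocycle.isCoalgebraStructure (hA : ∀ a : A,
    Coalgebra.comul (R := ℂ) (star a) = star (Coalgebra.comul (R := ℂ) a)) {Ω : A ⊗[ℂ] A}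
    (h : IsCounitalTwoCocycle Coalgebra.comul Coalgebra.counit Ω)
    (hε₁ : sliceLeft Coalgebra.counit (star Ω) = 1)
    (hε₂ : sliceRight Coalgebra.counit (star Ω) = 1) :
    IsCoalgebraStructure (twistComul Coalgebra.comul Ω) Coalgebra.counit where
  coassoc a := by
    have h₁ : ∀ t : A ⊗[ℂ] A, (twistComul Coalgebra.comul Ω).rTensor A t = (Ω ⊗ₜ[ℂ] (1 : A)) *
        (Coalgebra.comul (R := ℂ)).rTensor A t * (star Ω ⊗ₜ[ℂ] (1 : A)) := fun t => by
      induction t with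
      | zero => simp
      | add x y hx hy => simp only [map_add, mul_add, add_mul, hx, hy]
      | tmul x y => simp [twistComul_apply]
    have h₂ : ∀ t : A ⊗[ℂ] A, (twistComul Coalgebra.comul Ω).lTensor A t = ((1 : A) ⊗ₜ[ℂ] Ω) *
        (Coalgebra.comul (R := ℂ)).lTensor A t * ((1 : A) ⊗ₜ[ℂ] star Ω) := fun t => by
      induction t with
      | zero => simp
      | add x y hx hy => simp only [map_add, mul_add, add_mul, hx, hy]
      | tmul x y => simp [twistComul_apply]
    -- Both iterated comultiplications are the untwisted one between a side of the cocycle identity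
    -- and its adjoint. The adjoint identity treats the factors Ω* on the right.
    have hs := congrArg star h.cocycle
    rw [← assoc_tensor_star, star_mul, star_mul, TensorProduct.star_tmul, star_one,
      TensorProduct.star_tmul, star_one, ← comul_rTensor_star hA, ← comul_lTensor_star hA] at hs
    rw [h₁, h₂, twistComul_apply, comul_rTensor_mul, comul_rTensor_mul, comul_lTensor_mul,
      comul_lTensor_mul, ← mul_assoc, ← mul_assoc, mul_assoc, assoc_tensor_mul, hs,
      assoc_tensor_mul, h.cocycle, Coalgebra.coassoc_apply]
    simp only [mul_assoc]
  counit_left a := by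
    rw [twistComul_apply, sliceLeft_counit_mul, sliceLeft_counit_mul, h.counit_left, hε₁, one_mul,
      mul_one, sliceLeft, LinearMap.comp_apply, Coalgebra.rTensor_counit_comul]
    simp
  counit_right a := by
    rw [twistComul_apply, sliceRight_counit_mul, sliceRight_counit_mul, h.counit_right, hε₂,
      one_mul, mul_one, sliceRight, LinearMap.comp_apply, Coalgebra.lTensor_counit_comul]
    simp

end Twisting

/-! ### The Kac algebra structure of a group algebra. -/

section GroupAlgebraKac

variable {G : Type*} [Group G]

theorem groupAlgebra_induction {p : MonoidAlgebra ℂ G → Prop} (h0 : p 0)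
    (hadd : ∀ x y, p x → p y → p (x + y)) (hs : ∀ (c : ℂ) g, p (c • grpElt g)) (x) : p x := by
  induction x using MonoidAlgebra.induction_linear with
  | zero => exact h0
  | add x y hx hy => exact hadd x y hx hy
  | single g c => simpa [grpElt] using hs c g

theorem grpElt_mul (g h : G) : grpElt (g * h) = grpElt g * grpElt h := by
  simp [grpElt, MonoidAlgebra.single_mul_single]

theorem grpElt_one : grpElt (1 : G) = 1 := rfl

theorem star_grpElt (g : G) : star (grpElt g) = grpElt g⁻¹ := by
  simp [grpElt, star_groupAlgebra_single]

theorem comul_grpElt (g : G) : Coalgebra.comul (R := ℂ) (grpElt g) = grpElt g ⊗ₜ grpElt g := by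
  simp [grpElt]

theorem counit_grpElt (g : G) : Coalgebra.counit (R := ℂ) (grpElt g) = (1 : ℂ) := by
  simp [grpElt]

theorem antipode_grpElt (g : G) : HopfAlgebra.antipode ℂ (grpElt g) = grpElt g⁻¹ := by
  simp [grpElt]

theorem groupTrace_grpElt [DecidableEq G] (g : G) :
    groupTrace G (grpElt g) = if g = 1 then 1 else 0 := by
  change (MonoidAlgebra.single g (1 : ℂ)).coeff 1 = _
  simp [MonoidAlgebra.coeff_single, Finsupp.single_apply]

theorem groupStarAut_grpElt (φ : G ≃* G) (g : G) :
    groupStarAut φ (grpElt g) = grpElt (φ g) := by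
  change MonoidAlgebra.domCongr ℂ ℂ φ (MonoidAlgebra.single g 1) = _
  simp [grpElt]

theorem comul_groupAlgebra_star (x : MonoidAlgebra ℂ G) :
    Coalgebra.comul (R := ℂ) (star x) = star (Coalgebra.comul (R := ℂ) x) := by
  induction x using groupAlgebra_induction with
  | h0 => simp
  | hadd x y hx hy => simp [hx, hy]
  | hs c g => simp [comul_grpElt, star_grpElt, star_smul]

theorem counit_groupAlgebra_star (x : MonoidAlgebra ℂ G) :
    Coalgebra.counit (R := ℂ) (star x) = star (Coalgebra.counit (R := ℂ) x) := by
  induction x using groupAlgebra_induction with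
  | h0 => simp
  | hadd x y hx hy => simp [hx, hy]
  | hs c g => simp [counit_grpElt, star_grpElt, star_smul]

theorem antipode_groupAlgebra_star (x : MonoidAlgebra ℂ G) :
    HopfAlgebra.antipode ℂ (star x) = star (HopfAlgebra.antipode ℂ x) := by
  induction x using groupAlgebra_induction with
  | h0 => simp
  | hadd x y hx hy => simp [hx, hy]
  | hs c g => simp [antipode_grpElt, star_grpElt, star_smul]

theorem antipode_groupAlgebra_mul (x y : MonoidAlgebra ℂ G) :
    HopfAlgebra.antipode ℂ (x * y) = HopfAlgebra.antipode ℂ y * HopfAlgebra.antipode ℂ x := by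
  induction x using groupAlgebra_induction with
  | h0 => simp
  | hadd x y hx hy => simp [add_mul, mul_add, hx, hy]
  | hs c g =>
    induction y using groupAlgebra_induction with
    | h0 => simp
    | hadd x y hx hy => simp_all [add_mul, mul_add]
    | hs d h =>
      rw [smul_mul_smul_comm, ← grpElt_mul, map_smul, antipode_grpElt, map_smul, map_smul,
        antipode_grpElt, antipode_grpElt, smul_mul_smul_comm, ← grpElt_mul, mul_inv_rev, mul_comm]

theorem antipode_groupAlgebra_antipode (x : MonoidAlgebra ℂ G) :
    HopfAlgebra.antipode ℂ (HopfAlgebra.antipode ℂ x) = x := by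
  induction x using groupAlgebra_induction with
  | h0 => simp
  | hadd x y hx hy => simp [hx, hy]
  | hs c g => simp [antipode_grpElt]

theorem groupTrace_antipode (x : MonoidAlgebra ℂ G) :
    groupTrace G (HopfAlgebra.antipode ℂ x) = groupTrace G x := by
  classical
  induction x using groupAlgebra_induction with
  | h0 => simp
  | hadd x y hx hy => simp [hx, hy]
  | hs c g => simp [antipode_grpElt, groupTrace_grpElt]

theorem groupTrace_mul_comm (x y : MonoidAlgebra ℂ G) :
    groupTrace G (x * y) = groupTrace G (y * x) := by
  classical
  induction x using groupAlgebra_induction with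
  | h0 => simp
  | hadd x y hx hy => simp [add_mul, mul_add, hx, hy]
  | hs c g =>
    induction y using groupAlgebra_induction with
    | h0 => simp
    | hadd x y hx hy => simp only [add_mul, mul_add, map_add, hx, hy]
    | hs d h =>
      rw [smul_mul_smul_comm, smul_mul_smul_comm, ← grpElt_mul, ← grpElt_mul, map_smul, map_smul,
        groupTrace_grpElt, groupTrace_grpElt, mul_comm d c]
      simp only [mul_eq_one_iff_eq_inv (a := g), mul_eq_one_iff_inv_eq (a := h), eq_comm]

theorem groupTrace_star_mul_self [Fintype G] (x : MonoidAlgebra ℂ G) :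
    groupTrace G (star x * x) = ∑ g, star (x.coeff g) * x.coeff g := by
  classical
  -- The trace is the diagonal entry at the neutral element in the regular representation.
  have := congrFun (congrFun (map_mul (regularRep G) (star x) x) 1) 1
  rw [map_star, Matrix.mul_apply] at this
  change (star x * x).coeff 1 = _
  simpa [regularRep, Matrix.star_apply] using this

theorem comul_antipode_groupAlgebra (x : MonoidAlgebra ℂ G) :
    Coalgebra.comul (R := ℂ) (HopfAlgebra.antipode ℂ x) =
      tensorFlip _ (TensorProduct.map (HopfAlgebra.antipode ℂ) (HopfAlgebra.antipode ℂ)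
        (Coalgebra.comul (R := ℂ) x)) := by
  induction x using groupAlgebra_induction with
  | h0 => simp
  | hadd x y hx hy => simp only [map_add, hx, hy]
  | hs c g => simp [antipode_grpElt, comul_grpElt]

end GroupAlgebraKac

/-! ### Characters of the Klein group and the scalar cocycle. -/

section Klein

/-- Integer values turn the character identities into finite checks for `decide`. -/
theorem kleinPairing_eq_intCast (x k : Klein) :
    kleinPairing x k = (((-1) ^ (x.1.val * k.1.val + x.2.val * k.2.val) : ℤ) : ℂ) := by
  simp [kleinPairing]

theorem kleinPairing_add_right (x k l : Klein) :
    kleinPairing x (k + l) = kleinPairing x k * kleinPairing x l := by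
  simp only [kleinPairing_eq_intCast]
  norm_cast
  revert x k l
  decide

theorem kleinPairing_comm (x k : Klein) : kleinPairing x k = kleinPairing k x := by
  simp only [kleinPairing, mul_comm]

theorem kleinPairing_add_left (x y k : Klein) :
    kleinPairing (x + y) k = kleinPairing x k * kleinPairing y k := by
  rw [kleinPairing_comm, kleinPairing_add_right, kleinPairing_comm x, kleinPairing_comm y]

theorem sum_kleinPairing (x : Klein) :
    ∑ k, kleinPairing x k = if x = 0 then 4 else 0 := by
  simp only [kleinPairing_eq_intCast]
  norm_cast
  revert x
  decide

theorem star_kleinPairing (x k : Klein) : star (kleinPairing x k) = kleinPairing x k := by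
  rw [kleinPairing_eq_intCast]
  simp

theorem klein_add_self (x : Klein) : x + x = 0 := by
  revert x
  decide

theorem klein_add_eq_zero {x y : Klein} : x + y = 0 ↔ x = y := by
  revert x y
  decide

theorem star_kleinCocycle (x y : Klein) : star (kleinCocycle x y) = kleinCocycle y x := by
  have h : ∀ x y : Klein, (x = 0 ∨ y = 0 ∨ x = y) ↔ (y = 0 ∨ x = 0 ∨ y = x) := by decide
  have h' : ∀ x y : Klein, ¬ (x = 0 ∨ y = 0 ∨ x = y) →
    (((x = (1, 0) ∧ y = (0, 1)) ∨ (x = (0, 1) ∧ y = (1, 1)) ∨ (x = (1, 1) ∧ y = (1, 0))) ↔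
    ¬ ((y = (1, 0) ∧ x = (0, 1)) ∨ (y = (0, 1) ∧ x = (1, 1)) ∨ (y = (1, 1) ∧ x = (1, 0)))) := by
    decide
  unfold kleinCocycle
  simp only [h y x]
  split_ifs with h₁ h₂ h₃ h₃
  · simp
  · exact absurd h₃ ((h' x y h₁).1 h₂)
  · simp
  · simp
  · exact absurd ((h' x y h₁).2 h₃) h₂

theorem kleinCocycle_mul_star (x y : Klein) : kleinCocycle x y * star (kleinCocycle x y) = 1 := by
  unfold kleinCocycle
  split_ifs <;> simp

theorem kleinCocycle_self (x : Klein) : kleinCocycle x x = 1 := by simp [kleinCocycle]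

theorem kleinCocycle_zero_left (x : Klein) : kleinCocycle 0 x = 1 := by simp [kleinCocycle]

theorem kleinCocycle_zero_right (x : Klein) : kleinCocycle x 0 = 1 := by simp [kleinCocycle]

/-- The exponent `m` with `ω(x, y) = i ^ m`. -/
def kleinExponent (x y : Klein) : ZMod 4 :=
  if x = 0 ∨ y = 0 ∨ x = y then 0
  else if (x = (1, 0) ∧ y = (0, 1)) ∨ (x = (0, 1) ∧ y = (1, 1)) ∨ (x = (1, 1) ∧ y = (1, 0))
    then 1
  else 3

theorem kleinCocycle_eq_pow (x y : Klein) :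
    kleinCocycle x y = Complex.I ^ (kleinExponent x y).val := by
  have h3 : Complex.I ^ 3 = -Complex.I := by rw [pow_succ, Complex.I_sq]; ring
  unfold kleinCocycle kleinExponent
  split_ifs
  · simp
  · exact (pow_one _).symm
  · exact h3.symm

/-- All values are powers of i, so the identity is a congruence of exponents modulo 4 over the 64
triples. -/
theorem kleinCocycle_cocycle (x y z : Klein) :
    kleinCocycle x y * kleinCocycle (x + y) z = kleinCocycle x (y + z) * kleinCocycle y z := by
  simp only [kleinCocycle_eq_pow, ← pow_add]
  have h : ∀ x y z : Klein,
      ((kleinExponent x y).val + (kleinExponent (x + y) z).val) % 4 =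
        ((kleinExponent x (y + z)).val + (kleinExponent y z).val) % 4 := by
    decide
  rw [Complex.I_pow_eq_pow_mod, h, ← Complex.I_pow_eq_pow_mod]

end Klein

/-! ### Spectral projections of H. -/

section DualProjections

variable {n : ℕ} (hn : 4 ≤ n)

/-- The embedding of the Klein group onto `H`. -/
def kleinPerm (k : Klein) : Equiv.Perm (Fin n) := permA hn ^ k.1.val * permB hn ^ k.2.val

theorem permA_mul_self : permA hn * permA hn = 1 := Equiv.swap_mul_self _ _

theorem permB_mul_self : permB hn * permB hn = 1 := Equiv.swap_mul_self _ _

theorem permA_commute_permB : Commute (permA hn) (permB hn) := by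
  refine Equiv.Perm.Disjoint.commute fun i => ?_
  by_cases h : i = ⟨0, by omega⟩ ∨ i = ⟨1, by omega⟩
  · right
    rw [permB, Equiv.swap_apply_of_ne_of_ne] <;> rcases h with rfl | rfl <;> simp
  · left
    rw [not_or] at h
    exact Equiv.swap_apply_of_ne_of_ne h.1 h.2

theorem pow_val_add {M : Type*} [Monoid M] {a : M} (ha : a * a = 1) (s t : ZMod 2) :
    a ^ (s + t).val = a ^ s.val * a ^ t.val := by
  rw [← pow_add, ZMod.val_add, ← pow_mod_orderOf a (s.val + t.val),
    ← pow_mod_orderOf a ((s.val + t.val) % 2),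
    Nat.mod_mod_of_dvd _ (orderOf_dvd_of_pow_eq_one (by rw [pow_two, ha]))]

theorem kleinPerm_add (k l : Klein) : kleinPerm hn (k + l) = kleinPerm hn k * kleinPerm hn l := by
  have := (permA_commute_permB hn).pow_pow l.1.val k.2.val
  simp only [kleinPerm, Prod.fst_add, Prod.snd_add, pow_val_add (permA_mul_self hn),
    pow_val_add (permB_mul_self hn)]
  rw [mul_assoc, mul_assoc, ← mul_assoc (permA hn ^ l.1.val), this.eq, mul_assoc]

theorem kleinPerm_zero : kleinPerm hn 0 = 1 := by simp [kleinPerm]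

theorem kleinPerm_inv (k : Klein) : (kleinPerm hn k)⁻¹ = kleinPerm hn k := by
  rw [inv_eq_iff_mul_eq_one, ← kleinPerm_add, klein_add_self, kleinPerm_zero]

theorem dualProj_eq (x : Klein) :
    dualProj hn x = (1 / 4 : ℂ) • ∑ k, kleinPairing x k • grpElt (kleinPerm hn k) := rfl

/-- Translation by k permutes the terms of the sum and pulls out the character value, which is its
own inverse. The product and comultiplication rules for the P_x follow from this and orthogonality
of characters. -/
theorem grpElt_kleinPerm_mul_dualProj (k x : Klein) :
    grpElt (kleinPerm hn k) * dualProj hn x = kleinPairing x k • dualProj hn x := by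
  rw [dualProj_eq, mul_smul_comm, smul_comm (kleinPairing x k), Finset.mul_sum]
  congr 1
  rw [Finset.smul_sum]
  refine Fintype.sum_equiv (Equiv.addLeft k) _ _ fun l => ?_
  rw [mul_smul_comm, ← grpElt_mul, ← kleinPerm_add, Equiv.coe_addLeft, kleinPairing_add_right,
    smul_smul, ← mul_assoc, ← kleinPairing_add_left, klein_add_self]
  simp [kleinPairing]

theorem dualProj_mul_grpElt_kleinPerm (k x : Klein) :
    dualProj hn x * grpElt (kleinPerm hn k) = kleinPairing x k • dualProj hn x := by
  rw [← grpElt_kleinPerm_mul_dualProj, dualProj_eq, mul_smul_comm, smul_mul_assoc,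
    Finset.mul_sum, Finset.sum_mul]
  congr 1
  refine Finset.sum_congr rfl fun l _ => ?_
  rw [mul_smul_comm, smul_mul_assoc, ← grpElt_mul, ← grpElt_mul, ← kleinPerm_add, ← kleinPerm_add,
    add_comm]

theorem dualProj_mul (x y : Klein) :
    dualProj hn x * dualProj hn y = if x = y then dualProj hn y else 0 := by
  conv_lhs => rw [dualProj_eq, smul_mul_assoc, Finset.sum_mul]
  simp only [smul_mul_assoc, grpElt_kleinPerm_mul_dualProj, smul_smul, ← kleinPairing_add_left]
  rw [← Finset.sum_smul, sum_kleinPairing, smul_smul]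
  simp only [klein_add_eq_zero]
  split_ifs <;> simp

theorem sum_dualProj : ∑ x, dualProj hn x = 1 := by
  simp only [dualProj_eq]
  rw [← Finset.smul_sum, Finset.sum_comm]
  have h : ∀ k, ∑ x, kleinPairing x k = if k = 0 then 4 else 0 := fun k => by
    simp only [kleinPairing_comm _ k, sum_kleinPairing]
  simp only [← Finset.sum_smul, h]
  simp [kleinPerm_zero, grpElt_one]

theorem star_dualProj (x : Klein) : star (dualProj hn x) = dualProj hn x := by
  simp only [dualProj_eq, star_smul, star_sum, star_kleinPairing, star_grpElt, kleinPerm_inv]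
  simp

theorem antipode_dualProj (x : Klein) :
    HopfAlgebra.antipode ℂ (dualProj hn x) = dualProj hn x := by
  simp only [dualProj_eq, map_smul, map_sum, antipode_grpElt, kleinPerm_inv]

theorem counit_dualProj (x : Klein) :
    Coalgebra.counit (R := ℂ) (dualProj hn x) = if x = 0 then (1 : ℂ) else 0 := by
  simp only [dualProj_eq, map_smul, map_sum, counit_grpElt, smul_eq_mul, mul_one,
    sum_kleinPairing]
  split_ifs <;> simp

/-- On P_x ⊗ P_y the element λ(h) ⊗ λ(h) acts through the character x + y, and orthogonality selects
w = x + y. -/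
theorem comul_dualProj_mul (w x y : Klein) :
    Coalgebra.comul (R := ℂ) (dualProj hn w) * (dualProj hn x ⊗ₜ[ℂ] dualProj hn y) =
      if w = x + y then dualProj hn x ⊗ₜ[ℂ] dualProj hn y else 0 := by
  conv_lhs => rw [dualProj_eq]
  simp only [map_smul, map_sum, comul_grpElt, smul_mul_assoc, Finset.sum_mul,
    Algebra.TensorProduct.tmul_mul_tmul, grpElt_kleinPerm_mul_dualProj,
    TensorProduct.smul_tmul_smul, smul_smul, ← kleinPairing_add_left]
  rw [← Finset.sum_smul, sum_kleinPairing, smul_smul]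
  simp only [klein_add_eq_zero]
  split_ifs <;> simp

/-- The support lies in the coset Hg, which misses the neutral element. -/
theorem groupTrace_dualProj_mul_grpElt (x : Klein) {g : Equiv.Perm (Fin n)}
    (hg : ∀ k, kleinPerm hn k ≠ g) :
    groupTrace _ (dualProj hn x * grpElt g) = 0 := by
  simp only [dualProj_eq, smul_mul_assoc, Finset.sum_mul, map_smul, map_sum, ← grpElt_mul,
    groupTrace_grpElt]
  rw [Finset.sum_eq_zero, smul_zero]
  intro k _
  rw [if_neg, smul_zero]
  intro h
  apply hg k
  rw [← kleinPerm_inv, inv_eq_of_mul_eq_one_right h]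

end DualProjections

/-! ### Elements diagonal in the projections P_x ⊗ P_y. -/

section DiagonalElements

variable {n : ℕ} (hn : 4 ≤ n)

/-- The element `∑ w(x, y) P_x ⊗ P_y`. -/
noncomputable def diagElt (w : Klein → Klein → ℂ) :
    MonoidAlgebra ℂ (Equiv.Perm (Fin n)) ⊗[ℂ] MonoidAlgebra ℂ (Equiv.Perm (Fin n)) :=
  ∑ x, ∑ y, w x y • (dualProj hn x ⊗ₜ[ℂ] dualProj hn y)

theorem symOmega_eq : symOmega hn = diagElt hn kleinCocycle := rfl

theorem diagElt_mul_tmul (w : Klein → Klein → ℂ) (x y : Klein) :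
    diagElt hn w * (dualProj hn x ⊗ₜ[ℂ] dualProj hn y) =
      w x y • (dualProj hn x ⊗ₜ[ℂ] dualProj hn y) := by
  simp only [diagElt, Finset.sum_mul, smul_mul_assoc, Algebra.TensorProduct.tmul_mul_tmul,
    dualProj_mul]
  rw [Finset.sum_eq_single x, Finset.sum_eq_single y]
  · simp
  · intro z _ hz
    simp [hz]
  · simp
  · intro z _ hz
    simp [hz]
  · simp

theorem tmul_mul_diagElt (w : Klein → Klein → ℂ) (x y : Klein) :
    (dualProj hn x ⊗ₜ[ℂ] dualProj hn y) * diagElt hn w =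
      w x y • (dualProj hn x ⊗ₜ[ℂ] dualProj hn y) := by
  simp only [diagElt, Finset.mul_sum, mul_smul_comm, Algebra.TensorProduct.tmul_mul_tmul,
    dualProj_mul]
  rw [Finset.sum_eq_single x, Finset.sum_eq_single y]
  · simp
  · intro z _ hz
    simp [hz.symm]
  · simp
  · intro z _ hz
    simp [hz.symm]
  · simp

theorem sum_dualProj_tmul_dualProj : ∑ x, ∑ y, dualProj hn x ⊗ₜ[ℂ] dualProj hn y = 1 := by
  simp only [← TensorProduct.tmul_sum, ← TensorProduct.sum_tmul, sum_dualProj]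
  rfl

theorem diagElt_mul (v w : Klein → Klein → ℂ) :
    diagElt hn v * diagElt hn w = diagElt hn (fun x y => v x y * w x y) := by
  conv_lhs => rw [diagElt.eq_def hn w]
  simp only [Finset.mul_sum, mul_smul_comm, diagElt_mul_tmul, smul_smul, mul_comm (v _ _)]
  simp only [diagElt]

theorem diagElt_one : diagElt hn (fun _ _ => 1) = 1 := by
  simp only [diagElt, one_smul, sum_dualProj_tmul_dualProj]

theorem star_diagElt (w : Klein → Klein → ℂ) :
    star (diagElt hn w) = diagElt hn (fun x y => star (w x y)) := by
  simp only [diagElt, star_sum, star_smul, TensorProduct.star_tmul, star_dualProj]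

theorem tensorFlip_diagElt (w : Klein → Klein → ℂ) :
    tensorFlip _ (diagElt hn w) = diagElt hn (fun x y => w y x) := by
  simp only [diagElt, map_sum, map_smul, tensorFlip_tmul]
  exact Finset.sum_comm

theorem map_antipode_diagElt (w : Klein → Klein → ℂ) :
    TensorProduct.map (HopfAlgebra.antipode ℂ) (HopfAlgebra.antipode ℂ) (diagElt hn w) =
      diagElt hn w := by
  simp only [diagElt, map_sum, map_smul, TensorProduct.map_tmul, antipode_dualProj]

theorem sliceLeft_counit_diagElt {w : Klein → Klein → ℂ} (hw : ∀ y, w 0 y = 1) :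
    sliceLeft Coalgebra.counit (diagElt hn w) = 1 := by
  simp only [diagElt, map_sum, map_smul, sliceLeft_tmul, counit_dualProj]
  rw [Finset.sum_eq_single 0]
  · simp [hw, sum_dualProj]
  · intro x _ hx
    simp [hx]
  · simp

theorem sliceRight_counit_diagElt {w : Klein → Klein → ℂ} (hw : ∀ y, w y 0 = 1) :
    sliceRight Coalgebra.counit (diagElt hn w) = 1 := by
  simp only [diagElt, map_sum, map_smul, sliceRight_tmul, counit_dualProj]
  rw [Finset.sum_comm, Finset.sum_eq_single 0]
  · simp [hw, sum_dualProj]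
  · intro x _ hx
    simp [hx]
  · simp

theorem sum_sum_smul_dualProj_mul {w : Klein → Klein → ℂ} (hw : ∀ y, w y y = 1) :
    ∑ x, ∑ y, w x y • (dualProj hn x * dualProj hn y) = 1 := by
  simp [dualProj_mul, hw, sum_dualProj]

/-- The antipode reverses products and fixes the P_x, so P_x and P_y meet in the middle; only x = y
survives, with weight 1. This and its three companions below remove Ω and Ω* from the antipode laws.
-/
theorem mul_rTensor_antipode_diagElt_mul {w : Klein → Klein → ℂ} (hw : ∀ y, w y y = 1)
    (t : MonoidAlgebra ℂ (Equiv.Perm (Fin n)) ⊗[ℂ] MonoidAlgebra ℂ (Equiv.Perm (Fin n))) :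
    LinearMap.mul' ℂ _ ((HopfAlgebra.antipode ℂ).rTensor _ (diagElt hn w * t)) =
      LinearMap.mul' ℂ _ ((HopfAlgebra.antipode ℂ).rTensor _ t) := by
  induction t with
  | zero => simp
  | add x y hx hy => simp only [mul_add, map_add, hx, hy]
  | tmul c d =>
    have := congrArg (fun z => HopfAlgebra.antipode ℂ c * z * d) (sum_sum_smul_dualProj_mul hn hw)
    simp only [Finset.mul_sum, Finset.sum_mul, mul_smul_comm, smul_mul_assoc, mul_one] at this
    simp only [diagElt, Finset.sum_mul, smul_mul_assoc, Algebra.TensorProduct.tmul_mul_tmul,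
      map_sum, map_smul, LinearMap.rTensor_tmul, LinearMap.mul'_apply, antipode_groupAlgebra_mul,
      antipode_dualProj]
    simpa only [mul_assoc] using this

theorem mul_lTensor_antipode_mul_diagElt {w : Klein → Klein → ℂ} (hw : ∀ y, w y y = 1)
    (t : MonoidAlgebra ℂ (Equiv.Perm (Fin n)) ⊗[ℂ] MonoidAlgebra ℂ (Equiv.Perm (Fin n))) :
    LinearMap.mul' ℂ _ ((HopfAlgebra.antipode ℂ).lTensor _ (t * diagElt hn w)) =
      LinearMap.mul' ℂ _ ((HopfAlgebra.antipode ℂ).lTensor _ t) := by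
  induction t with
  | zero => simp
  | add x y hx hy => simp only [add_mul, map_add, hx, hy]
  | tmul c d =>
    have := congrArg (fun z => c * z * HopfAlgebra.antipode ℂ d) (sum_sum_smul_dualProj_mul hn hw)
    simp only [Finset.mul_sum, Finset.sum_mul, mul_smul_comm, smul_mul_assoc, mul_one] at this
    simp only [diagElt, Finset.mul_sum, mul_smul_comm, Algebra.TensorProduct.tmul_mul_tmul,
      map_sum, map_smul, LinearMap.lTensor_tmul, LinearMap.mul'_apply, antipode_groupAlgebra_mul,
      antipode_dualProj]
    simpa only [mul_assoc] using this

theorem mul_rTensor_antipode_grpElt_mul_diagElt {w : Klein → Klein → ℂ} (hw : ∀ y, w y y = 1)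
    (g : Equiv.Perm (Fin n)) :
    LinearMap.mul' ℂ _ ((HopfAlgebra.antipode ℂ).rTensor _
      ((grpElt g ⊗ₜ[ℂ] grpElt g) * diagElt hn w)) = 1 := by
  simp only [diagElt, Finset.mul_sum, mul_smul_comm, Algebra.TensorProduct.tmul_mul_tmul,
    map_sum, map_smul, LinearMap.rTensor_tmul, LinearMap.mul'_apply, antipode_groupAlgebra_mul,
    antipode_dualProj, antipode_grpElt]
  have h : ∀ x y, dualProj hn x * grpElt g⁻¹ * (grpElt g * dualProj hn y) =
      dualProj hn x * dualProj hn y := fun x y => by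
    rw [mul_assoc, ← mul_assoc (grpElt g⁻¹), ← grpElt_mul, inv_mul_cancel, grpElt_one, one_mul]
  simp only [h, sum_sum_smul_dualProj_mul hn hw]

theorem mul_lTensor_antipode_diagElt_mul_grpElt {w : Klein → Klein → ℂ} (hw : ∀ y, w y y = 1)
    (g : Equiv.Perm (Fin n)) :
    LinearMap.mul' ℂ _ ((HopfAlgebra.antipode ℂ).lTensor _
      (diagElt hn w * (grpElt g ⊗ₜ[ℂ] grpElt g))) = 1 := by
  simp only [diagElt, Finset.sum_mul, smul_mul_assoc, Algebra.TensorProduct.tmul_mul_tmul,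
    map_sum, map_smul, LinearMap.lTensor_tmul, LinearMap.mul'_apply, antipode_groupAlgebra_mul,
    antipode_dualProj, antipode_grpElt]
  have h : ∀ x y, dualProj hn x * grpElt g * (grpElt g⁻¹ * dualProj hn y) =
      dualProj hn x * dualProj hn y := fun x y => by
    rw [mul_assoc, ← mul_assoc (grpElt g), ← grpElt_mul, mul_inv_cancel, grpElt_one, one_mul]
  simp only [h, sum_sum_smul_dualProj_mul hn hw]

/-- The trace property together with P_x P_x' = 0 for x ≠ x' makes the first-leg indices agree. If g
lies in H, λ(g) commutes with the projections, the second-leg indices agree too, and the weights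
cancel. If not, every trace vanishes. -/
theorem sliceLeft_groupTrace_diagElt {v w : Klein → Klein → ℂ} (hvw : ∀ x y, v x y * w x y = 1)
    (g : Equiv.Perm (Fin n)) :
    sliceLeft (groupTrace _) (diagElt hn v * (grpElt g ⊗ₜ[ℂ] grpElt g) * diagElt hn w) =
      groupTrace _ (grpElt g) • 1 := by
  have hμ : groupTrace _ (grpElt g) = ∑ x, groupTrace _ (dualProj hn x * grpElt g) := by
    rw [← map_sum, ← Finset.sum_mul, sum_dualProj, one_mul]
  have htr : ∀ x x', groupTrace _ (dualProj hn x * grpElt g * dualProj hn x') =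
      if x' = x then groupTrace _ (dualProj hn x * grpElt g) else 0 := fun x x' => by
    rw [groupTrace_mul_comm, ← mul_assoc, dualProj_mul]
    split_ifs <;> simp
  simp only [diagElt, Finset.sum_mul, Finset.mul_sum, smul_mul_assoc, mul_smul_comm,
    Algebra.TensorProduct.tmul_mul_tmul, map_sum, map_smul, sliceLeft_tmul, htr]
  by_cases hg : ∃ k, kleinPerm hn k = g
  · obtain ⟨k, rfl⟩ := hg
    -- The trace is nonzero only at the neutral element, so the unit on the right may be replaced by
    -- λ(g) and then expanded in the projections.
    have hz : groupTrace _ (grpElt (kleinPerm hn k)) • grpElt (kleinPerm hn k) =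
        groupTrace _ (grpElt (kleinPerm hn k)) •
          (1 : MonoidAlgebra ℂ (Equiv.Perm (Fin n))) := by
      rw [groupTrace_grpElt]
      split_ifs with h
      · rw [h, grpElt_one]
      · simp
    have hP : ∀ y y', dualProj hn y * grpElt (kleinPerm hn k) * dualProj hn y' =
        if y = y' then dualProj hn y * grpElt (kleinPerm hn k) else 0 := fun y y' => by
      rw [mul_assoc, grpElt_kleinPerm_mul_dualProj, mul_smul_comm, dualProj_mul,
        dualProj_mul_grpElt_kleinPerm]
      split_ifs with h
      · rw [h]
      · simp
    rw [← hz]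
    conv_rhs => rw [← one_mul (grpElt (kleinPerm hn k)), ← sum_dualProj hn, Finset.sum_mul,
      map_sum, Finset.sum_smul]
    refine Finset.sum_congr rfl fun x _ => ?_
    rw [Finset.smul_sum]
    refine Finset.sum_congr rfl fun y _ => ?_
    simp only [hP, ite_smul, zero_smul, smul_ite, smul_zero, Finset.sum_ite_eq',
      Finset.sum_ite_eq, Finset.mem_univ, if_true]
    rw [smul_smul, mul_comm, hvw, one_smul]
  · rw [not_exists] at hg
    rw [hμ]
    simp [groupTrace_dualProj_mul_grpElt hn _ hg]

theorem sliceRight_groupTrace_diagElt {v w : Klein → Klein → ℂ} (hvw : ∀ x y, v x y * w x y = 1)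
    (g : Equiv.Perm (Fin n)) :
    sliceRight (groupTrace _) (diagElt hn v * (grpElt g ⊗ₜ[ℂ] grpElt g) * diagElt hn w) =
      groupTrace _ (grpElt g) • 1 := by
  have hflip : ∀ t : MonoidAlgebra ℂ (Equiv.Perm (Fin n)) ⊗[ℂ] MonoidAlgebra ℂ (Equiv.Perm (Fin n)),
      sliceRight (groupTrace _) t = sliceLeft (groupTrace _) (tensorFlip _ t) := fun t => by
    induction t with
    | zero => simp
    | add x y hx hy => simp only [map_add, hx, hy]
    | tmul x y => simp
  have hmul : ∀ s t : MonoidAlgebra ℂ (Equiv.Perm (Fin n)) ⊗[ℂ]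
      MonoidAlgebra ℂ (Equiv.Perm (Fin n)),
      tensorFlip _ (s * t) = tensorFlip _ s * tensorFlip _ t :=
    map_mul (Algebra.TensorProduct.comm ℂ _ _)
  rw [hflip, hmul, hmul, tensorFlip_diagElt, tensorFlip_diagElt, tensorFlip_tmul,
    sliceLeft_groupTrace_diagElt hn fun x y => hvw y x]

end DiagonalElements

/-! ### Lifting a scalar cocycle along orthogonal idempotents. -/

section Idempotents

variable {A : Type*} [Ring A] [Bialgebra ℂ A] {P : Klein → A}

theorem comul_rTensor_sum_mul (hmul : ∀ x y, P x * P y = if x = y then P y else 0)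
    (hcomul : ∀ v x y, Coalgebra.comul (R := ℂ) (P v) * (P x ⊗ₜ[ℂ] P y) =
      if v = x + y then P x ⊗ₜ[ℂ] P y else 0) (w : Klein → Klein → ℂ) (x y z : Klein) :
    (Coalgebra.comul (R := ℂ)).rTensor A (∑ x, ∑ y, w x y • (P x ⊗ₜ[ℂ] P y)) *
      ((P x ⊗ₜ[ℂ] P y) ⊗ₜ[ℂ] P z) = w (x + y) z • ((P x ⊗ₜ[ℂ] P y) ⊗ₜ[ℂ] P z) := by
  simp only [map_sum, map_smul, LinearMap.rTensor_tmul, Finset.sum_mul, smul_mul_assoc,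
    Algebra.TensorProduct.tmul_mul_tmul, hcomul, hmul]
  rw [Finset.sum_eq_single (x + y), Finset.sum_eq_single z]
  · simp
  · intro v _ hv
    simp [hv]
  · simp
  · intro v _ hv
    simp [hv]
  · simp

theorem comul_lTensor_sum_mul (hmul : ∀ x y, P x * P y = if x = y then P y else 0)
    (hcomul : ∀ v x y, Coalgebra.comul (R := ℂ) (P v) * (P x ⊗ₜ[ℂ] P y) =
      if v = x + y then P x ⊗ₜ[ℂ] P y else 0) (w : Klein → Klein → ℂ) (x y z : Klein) :
    (Coalgebra.comul (R := ℂ)).lTensor A (∑ x, ∑ y, w x y • (P x ⊗ₜ[ℂ] P y)) *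
      (P x ⊗ₜ[ℂ] (P y ⊗ₜ[ℂ] P z)) = w x (y + z) • (P x ⊗ₜ[ℂ] (P y ⊗ₜ[ℂ] P z)) := by
  simp only [map_sum, map_smul, LinearMap.lTensor_tmul, Finset.sum_mul, smul_mul_assoc,
    Algebra.TensorProduct.tmul_mul_tmul, hcomul, hmul]
  rw [Finset.sum_eq_single x, Finset.sum_eq_single (y + z)]
  · simp
  · intro v _ hv
    simp [hv]
  · simp
  · intro v _ hv
    simp [hv]
  · simp

/-- A 2-cocycle on the dual of the Klein group lifts to a 2-cocycle of a bialgebra. -/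
theorem cocycle_of_idempotents (hsum : ∑ x, P x = 1) {w : Klein → Klein → ℂ}
    (hΩ : ∀ x y, (∑ x, ∑ y, w x y • (P x ⊗ₜ[ℂ] P y)) * (P x ⊗ₜ[ℂ] P y) =
      w x y • (P x ⊗ₜ[ℂ] P y))
    (hmul : ∀ x y, P x * P y = if x = y then P y else 0)
    (hcomul : ∀ v x y, Coalgebra.comul (R := ℂ) (P v) * (P x ⊗ₜ[ℂ] P y) =
      if v = x + y then P x ⊗ₜ[ℂ] P y else 0)
    (hw : ∀ x y z, w x y * w (x + y) z = w x (y + z) * w y z) :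
    TensorProduct.assoc ℂ A A A (((∑ x, ∑ y, w x y • (P x ⊗ₜ[ℂ] P y)) ⊗ₜ[ℂ] 1) *
      (Coalgebra.comul (R := ℂ)).rTensor A (∑ x, ∑ y, w x y • (P x ⊗ₜ[ℂ] P y))) =
    (1 ⊗ₜ[ℂ] (∑ x, ∑ y, w x y • (P x ⊗ₜ[ℂ] P y))) *
      (Coalgebra.comul (R := ℂ)).lTensor A (∑ x, ∑ y, w x y • (P x ⊗ₜ[ℂ] P y)) := by
  have h1 : ∑ x, ∑ y, ∑ z, P x ⊗ₜ[ℂ] (P y ⊗ₜ[ℂ] P z) = 1 := by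
    simp only [← TensorProduct.tmul_sum, ← TensorProduct.sum_tmul, hsum]
    rfl
  have h1' : ∑ x, ∑ y, ∑ z, (P x ⊗ₜ[ℂ] P y) ⊗ₜ[ℂ] P z = 1 := by
    simp only [← TensorProduct.tmul_sum, ← TensorProduct.sum_tmul, hsum]
    rfl
  have hr := comul_rTensor_sum_mul hmul hcomul w
  have hl := comul_lTensor_sum_mul hmul hcomul w
  generalize (∑ x, ∑ y, w x y • (P x ⊗ₜ[ℂ] P y)) = Ω at *
  -- Both sides are compared on the resolution of the unit by P_x ⊗ P_y ⊗ P_z, where every factor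
  -- acts by a scalar.
  rw [← mul_one (_ * LinearMap.rTensor _ _ _), ← h1',
    ← mul_one (_ * LinearMap.lTensor _ _ _), ← h1]
  simp only [Finset.mul_sum, mul_assoc, hr, hl, mul_smul_comm, Algebra.TensorProduct.tmul_mul_tmul,
    hΩ, one_mul, map_sum, map_smul, TensorProduct.assoc_tmul, TensorProduct.tmul_smul,
    ← TensorProduct.smul_tmul', smul_smul]
  simp only [← hw, mul_comm]

end Idempotents

/-! ### The twisted Kac algebra of the symmetric group and its automorphism. -/

section TwistedSymmetricGroup

variable {n : ℕ} (hn : 4 ≤ n)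

theorem star_symOmega : star (symOmega hn) = diagElt hn (fun x y => kleinCocycle y x) := by
  simp only [symOmega_eq, star_diagElt, star_kleinCocycle]

theorem kleinCocycle_mul_swap (x y : Klein) : kleinCocycle x y * kleinCocycle y x = 1 := by
  rw [← star_kleinCocycle x y, kleinCocycle_mul_star]

theorem tensorFlip_symOmega : tensorFlip _ (symOmega hn) = star (symOmega hn) := by
  rw [star_symOmega, symOmega_eq, tensorFlip_diagElt]

theorem tensorFlip_star_symOmega : tensorFlip _ (star (symOmega hn)) = symOmega hn := by
  rw [star_symOmega, symOmega_eq, tensorFlip_diagElt]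

theorem symOmega_mem_unitary : symOmega hn ∈ unitary _ := by
  rw [Unitary.mem_iff, star_symOmega, symOmega_eq, diagElt_mul, diagElt_mul]
  simp only [kleinCocycle_mul_swap, diagElt_one, and_self]

theorem symOmega_cocycle :
    TensorProduct.assoc ℂ _ _ _ ((symOmega hn ⊗ₜ[ℂ] 1) *
      (Coalgebra.comul (R := ℂ)).rTensor _ (symOmega hn)) =
    (1 ⊗ₜ[ℂ] symOmega hn) * (Coalgebra.comul (R := ℂ)).lTensor _ (symOmega hn) :=
  cocycle_of_idempotents (sum_dualProj hn) (diagElt_mul_tmul hn kleinCocycle) (dualProj_mul hn)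
    (comul_dualProj_mul hn) kleinCocycle_cocycle

theorem isCounitalTwoCocycle_symOmega :
    IsCounitalTwoCocycle (Coalgebra.comul (R := ℂ)) (symCounit n) (symOmega hn) where
  unitary := symOmega_mem_unitary hn
  cocycle := symOmega_cocycle hn
  counit_left := sliceLeft_counit_diagElt hn kleinCocycle_zero_left
  counit_right := sliceRight_counit_diagElt hn kleinCocycle_zero_right

/-- Only the diagonal terms ω(x, x) P_x = P_x survive, so the twisted antipode is the original one.
-/
theorem twistUnitary_symOmega : twistUnitary (HopfAlgebra.antipode ℂ) (symOmega hn) = 1 := by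
  simp only [twistUnitary, symOmega_eq, diagElt, map_sum, map_smul, LinearMap.lTensor_tmul,
    LinearMap.mul'_apply, antipode_dualProj]
  exact sum_sum_smul_dualProj_mul hn kleinCocycle_self

theorem symAntipode_eq : symAntipode hn = HopfAlgebra.antipode ℂ := by
  ext1 x
  simp [symAntipode, twistAntipode, twistUnitary_symOmega]

theorem symComul_apply (a : MonoidAlgebra ℂ (Equiv.Perm (Fin n))) :
    symComul hn a = symOmega hn * Coalgebra.comul (R := ℂ) a * star (symOmega hn) :=
  twistComul_apply _ a

theorem symComul_grpElt (g : Equiv.Perm (Fin n)) :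
    symComul hn (grpElt g) = symOmega hn * (grpElt g ⊗ₜ[ℂ] grpElt g) * star (symOmega hn) := by
  rw [symComul_apply, comul_grpElt]

theorem isCoalgebraStructure_symComul : IsCoalgebraStructure (symComul hn) (symCounit n) :=
  (isCounitalTwoCocycle_symOmega hn).isCoalgebraStructure comul_groupAlgebra_star
    (by rw [star_symOmega]; exact sliceLeft_counit_diagElt hn kleinCocycle_zero_right)
    (by rw [star_symOmega]; exact sliceRight_counit_diagElt hn kleinCocycle_zero_left)

theorem tensorFlip_mul {A : Type*} [Ring A] [Algebra ℂ A] (s t : A ⊗[ℂ] A) :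
    tensorFlip A (s * t) = tensorFlip A s * tensorFlip A t :=
  map_mul (Algebra.TensorProduct.comm ℂ A A) s t

theorem map_antipode_mul (s t : MonoidAlgebra ℂ (Equiv.Perm (Fin n)) ⊗[ℂ]
    MonoidAlgebra ℂ (Equiv.Perm (Fin n))) :
    TensorProduct.map (HopfAlgebra.antipode ℂ) (HopfAlgebra.antipode ℂ) (s * t) =
      TensorProduct.map (HopfAlgebra.antipode ℂ) (HopfAlgebra.antipode ℂ) t *
        TensorProduct.map (HopfAlgebra.antipode ℂ) (HopfAlgebra.antipode ℂ) s := by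
  induction s with
  | zero => simp
  | add x y hx hy => simp only [add_mul, mul_add, map_add, hx, hy]
  | tmul x y =>
    induction t with
    | zero => simp
    | add x y hx hy => simp only [add_mul, mul_add, map_add, hx, hy]
    | tmul u v => simp [antipode_groupAlgebra_mul]

/-- The map κ ⊗ κ fixes Ω and Ω* and reverses products, while the flip exchanges Ω with Ω*; the two
effects together restore ΩΔΩ*. -/
theorem symComul_antipode (a : MonoidAlgebra ℂ (Equiv.Perm (Fin n))) :
    symComul hn (HopfAlgebra.antipode ℂ a) = tensorFlip _
      (TensorProduct.map (HopfAlgebra.antipode ℂ) (HopfAlgebra.antipode ℂ) (symComul hn a)) := by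
  rw [symComul_apply, symComul_apply, map_antipode_mul, map_antipode_mul, tensorFlip_mul,
    tensorFlip_mul, ← comul_antipode_groupAlgebra, star_symOmega, map_antipode_diagElt,
    ← star_symOmega, tensorFlip_star_symOmega, symOmega_eq, map_antipode_diagElt, ← symOmega_eq,
    tensorFlip_symOmega, mul_assoc]

theorem symComul_mul_antipode_left (a : MonoidAlgebra ℂ (Equiv.Perm (Fin n))) :
    LinearMap.mul' ℂ _ ((HopfAlgebra.antipode ℂ).rTensor _ (symComul hn a)) =
      algebraMap ℂ _ (symCounit n a) := by
  induction a using groupAlgebra_induction with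
  | h0 => simp
  | hadd x y hx hy => simp only [map_add, hx, hy]
  | hs c g =>
    rw [map_smul, map_smul, map_smul, symComul_grpElt, mul_assoc, symOmega_eq,
      mul_rTensor_antipode_diagElt_mul hn kleinCocycle_self, ← symOmega_eq, star_symOmega,
      mul_rTensor_antipode_grpElt_mul_diagElt hn (w := fun x y => kleinCocycle y x)
        kleinCocycle_self, map_smul, symCounit,
      counit_grpElt, Algebra.algebraMap_eq_smul_one, smul_eq_mul, mul_one]

theorem symComul_mul_antipode_right (a : MonoidAlgebra ℂ (Equiv.Perm (Fin n))) :
    LinearMap.mul' ℂ _ ((HopfAlgebra.antipode ℂ).lTensor _ (symComul hn a)) =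
      algebraMap ℂ _ (symCounit n a) := by
  induction a using groupAlgebra_induction with
  | h0 => simp
  | hadd x y hx hy => simp only [map_add, hx, hy]
  | hs c g =>
    rw [map_smul, map_smul, map_smul, symComul_grpElt, star_symOmega,
      mul_lTensor_antipode_mul_diagElt hn (w := fun x y => kleinCocycle y x) kleinCocycle_self, symOmega_eq,
      mul_lTensor_antipode_diagElt_mul_grpElt hn kleinCocycle_self, map_smul, symCounit,
      counit_grpElt, Algebra.algebraMap_eq_smul_one, smul_eq_mul, mul_one]

theorem groupTrace_star_mul_self_nonneg {G : Type*} [Group G] [Fintype G] (x : MonoidAlgebra ℂ G) :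
    0 ≤ groupTrace G (star x * x) := by
  rw [groupTrace_star_mul_self]
  exact Finset.sum_nonneg fun g _ => star_mul_self_nonneg _

theorem isHaarState_groupTrace : IsHaarState (symComul hn) (groupTrace (Equiv.Perm (Fin n))) where
  map_one := by
    rw [← grpElt_one, groupTrace_grpElt, if_pos rfl]
  nonneg a ha := ha.induction (p := fun a => 0 ≤ groupTrace _ a) (by simp)
    (fun x y hx hy => by rw [map_add]; exact add_nonneg hx hy) groupTrace_star_mul_self_nonneg
  left_inv a := by
    induction a using groupAlgebra_induction with
    | h0 => simp
    | hadd x y hx hy => simp only [map_add, hx, hy, add_smul]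
    | hs c g =>
      rw [map_smul, map_smul, symComul_grpElt, star_symOmega, symOmega_eq,
        sliceLeft_groupTrace_diagElt hn kleinCocycle_mul_swap, map_smul, smul_assoc]
  right_inv a := by
    induction a using groupAlgebra_induction with
    | h0 => simp
    | hadd x y hx hy => simp only [map_add, hx, hy, add_smul]
    | hs c g =>
      rw [map_smul, map_smul, symComul_grpElt, star_symOmega, symOmega_eq,
        sliceRight_groupTrace_diagElt hn kleinCocycle_mul_swap, map_smul, smul_assoc]

theorem groupTrace_faithful {G : Type*} [Group G] [Fintype G] (x : MonoidAlgebra ℂ G)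
    (hx : groupTrace G (star x * x) = 0) : x = 0 := by
  rw [groupTrace_star_mul_self,
    Finset.sum_eq_zero_iff_of_nonneg fun g _ => star_mul_self_nonneg _] at hx
  ext g
  simpa using hx g (Finset.mem_univ g)

theorem isKacAlgebra_symComul : IsKacAlgebra (symComul hn) (symCounit n) (symAntipode hn)
    (groupTrace (Equiv.Perm (Fin n))) := by
  rw [symAntipode_eq]
  exact
  { isCoalgebraStructure_symComul hn with
    cstar := (hasFaithfulRep_groupAlgebra _).isFinDimCStarAlgebra
    comul_one := twistComul_one (symOmega_mem_unitary hn)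
    comul_mul := twistComul_mul (symOmega_mem_unitary hn)
    comul_star := twistComul_star comul_groupAlgebra_star _
    counit_one := Bialgebra.counit_one
    counit_mul := Bialgebra.counit_mul
    counit_star := counit_groupAlgebra_star
    antipode_mul := antipode_groupAlgebra_mul
    antipode_star := antipode_groupAlgebra_star
    antipode_antipode := antipode_groupAlgebra_antipode
    comul_antipode := symComul_antipode hn
    mul_antipode_left := symComul_mul_antipode_left hn
    mul_antipode_right := symComul_mul_antipode_right hn
    haar := isHaarState_groupTrace hn
    haar_trace := groupTrace_mul_comm
    haar_faithful := groupTrace_faithful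
    haar_antipode := groupTrace_antipode
    strong_inv := strong_invariance (isCoalgebraStructure_symComul hn)
      (twistComul_mul (symOmega_mem_unitary hn)) (symComul_mul_antipode_left hn)
      (isHaarState_groupTrace hn).right_inv }

theorem symGamma_grpElt (g : Equiv.Perm (Fin n)) :
    symGamma hn (grpElt g) = grpElt (permA hn * g * (permA hn)⁻¹) :=
  groupStarAut_grpElt _ g

theorem symGamma_apply (x : MonoidAlgebra ℂ (Equiv.Perm (Fin n))) :
    symGamma hn x = grpElt (permA hn) * x * grpElt (permA hn) := by
  have hi : (permA hn)⁻¹ = permA hn := inv_eq_of_mul_eq_one_left (permA_mul_self hn)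
  induction x using groupAlgebra_induction with
  | h0 => simp
  | hadd x y hx hy => rw [map_add, hx, hy, mul_add, add_mul]
  | hs c g =>
    rw [map_smul, symGamma_grpElt, hi, grpElt_mul, grpElt_mul, mul_smul_comm, smul_mul_assoc]

theorem kleinPerm_one_zero : kleinPerm hn (1, 0) = permA hn := by
  simp [kleinPerm, ZMod.val_one]

/-- Conjugation by a multiplies P_x by ⟨x, a⟩² = 1. Hence γ ⊗ γ fixes Ω and is compatible with the
twist. -/
theorem symGamma_dualProj (x : Klein) : symGamma hn (dualProj hn x) = dualProj hn x := by
  rw [symGamma_apply, ← kleinPerm_one_zero, grpElt_kleinPerm_mul_dualProj, smul_mul_assoc,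
    dualProj_mul_grpElt_kleinPerm, smul_smul, ← kleinPairing_add_right, klein_add_self]
  simp [kleinPairing]

theorem map_symGamma_mul (s t : MonoidAlgebra ℂ (Equiv.Perm (Fin n)) ⊗[ℂ]
    MonoidAlgebra ℂ (Equiv.Perm (Fin n))) :
    TensorProduct.map (symGamma hn).toAlgEquiv.toLinearMap (symGamma hn).toAlgEquiv.toLinearMap
      (s * t) =
    TensorProduct.map (symGamma hn).toAlgEquiv.toLinearMap (symGamma hn).toAlgEquiv.toLinearMap s *
      TensorProduct.map (symGamma hn).toAlgEquiv.toLinearMap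
        (symGamma hn).toAlgEquiv.toLinearMap t :=
  map_mul (Algebra.TensorProduct.map (symGamma hn).toAlgEquiv.toAlgHom
    (symGamma hn).toAlgEquiv.toAlgHom) s t

theorem map_symGamma_diagElt (w : Klein → Klein → ℂ) :
    TensorProduct.map (symGamma hn).toAlgEquiv.toLinearMap (symGamma hn).toAlgEquiv.toLinearMap
      (diagElt hn w) = diagElt hn w := by
  simp [diagElt, symGamma_dualProj]

theorem isKacAutomorphism_symGamma :
    IsKacAutomorphism (symComul hn) (symCounit n) (symAntipode hn) (symGamma hn) where
  comul a := by
    rw [symComul_apply, symComul_apply, map_symGamma_mul, map_symGamma_mul, star_symOmega,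
      symOmega_eq, map_symGamma_diagElt, map_symGamma_diagElt]
    congr 2
    induction a using groupAlgebra_induction with
    | h0 => simp
    | hadd x y hx hy => simp only [map_add, hx, hy]
    | hs c g => simp [symGamma_grpElt, comul_grpElt]
  counit a := by
    induction a using groupAlgebra_induction with
    | h0 => simp
    | hadd x y hx hy => simp only [map_add, hx, hy]
    | hs c g => simp [symGamma_grpElt, symCounit, counit_grpElt]
  antipode a := by
    rw [symAntipode_eq]
    induction a using groupAlgebra_induction with
    | h0 => simp
    | hadd x y hx hy => simp only [map_add, hx, hy]
    | hs c g => simp [symGamma_grpElt, antipode_grpElt, mul_assoc]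

theorem isKacAutomorphism_one {A : Type*} [Ring A] [StarRing A] [Algebra ℂ A]
    (Δ : A →ₗ[ℂ] A ⊗[ℂ] A) (ε : A →ₗ[ℂ] ℂ) (κ : A →ₗ[ℂ] A) : IsKacAutomorphism Δ ε κ 1 where
  comul a := by
    have : (1 : A ≃⋆ₐ[ℂ] A).toAlgEquiv.toLinearMap = LinearMap.id := rfl
    rw [this, TensorProduct.map_id]
    rfl
  counit _ := rfl
  antipode _ := rfl

theorem isDelsartHypergroup_symGroup : IsDelsartHypergroup (symGroup hn) (symComul hn)
    (symCounit n) (symAntipode hn) (groupTrace (Equiv.Perm (Fin n))) := by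
  refine (isKacAlgebra_symComul hn).isDelsartHypergroup (hasFaithfulRep_groupAlgebra _) ?_
  rintro γ (rfl | rfl)
  · exact isKacAutomorphism_one _ _ _
  · exact isKacAutomorphism_symGamma hn

end TwistedSymmetricGroup

/-! ### Noncommutativity and asymmetry, tested in the permutation representation. -/

section PermutationRepresentation

variable {n : ℕ} (hn : 4 ≤ n)

/-- The permutation representation of the group algebra. -/
noncomputable def permRep (n : ℕ) :
    MonoidAlgebra ℂ (Equiv.Perm (Fin n)) →ₐ[ℂ] Module.End ℂ (Fin n →₀ ℂ) :=
  MonoidAlgebra.lift ℂ _ _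
    { toFun := fun g => Finsupp.lmapDomain ℂ ℂ g
      map_one' := Finsupp.lmapDomain_id ℂ ℂ
      map_mul' := fun g h => Finsupp.lmapDomain_comp ℂ ℂ h g }

theorem permRep_grpElt (g : Equiv.Perm (Fin n)) (i : Fin n) (c : ℂ) :
    permRep n (grpElt g) (.single i c) = .single (g i) c := by
  simp only [permRep, grpElt, MonoidAlgebra.lift_single, one_smul]
  exact Finsupp.mapDomain_single

/-- The transposition `(23)`. -/
def permC : Equiv.Perm (Fin n) := Equiv.swap ⟨1, by omega⟩ ⟨2, by omega⟩

/-- The vector `e_i` for `i < 4`. -/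
noncomputable def stdVec (i : Fin 4) : Fin n →₀ ℂ := .single (Fin.castLE hn i) 1

theorem permRep_permA (i : Fin 4) :
    permRep n (grpElt (permA hn)) (stdVec hn i) = stdVec hn (Equiv.swap 0 1 i) := by
  rw [stdVec, permRep_grpElt, stdVec]
  congr 1
  fin_cases i <;> simp [permA, Equiv.swap_apply_def, Fin.ext_iff]

theorem permRep_permB (i : Fin 4) :
    permRep n (grpElt (permB hn)) (stdVec hn i) = stdVec hn (Equiv.swap 2 3 i) := by
  rw [stdVec, permRep_grpElt, stdVec]
  congr 1
  fin_cases i <;> simp [permB, Equiv.swap_apply_def, Fin.ext_iff]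

theorem permRep_permC (i : Fin 4) :
    permRep n (grpElt (permC hn)) (stdVec hn i) = stdVec hn (Equiv.swap 1 2 i) := by
  rw [stdVec, permRep_grpElt, stdVec]
  congr 1
  fin_cases i <;> simp [permC, Equiv.swap_apply_def, Fin.ext_iff]

theorem stdVec_apply (i j : Fin 4) :
    stdVec hn i (Fin.castLE hn j) = if i = j then 1 else 0 := by
  simp [stdVec, Finsupp.single_apply, Fin.ext_iff]

theorem dualProj_eq_sum_four (x : Klein) : dualProj hn x = (1 / 4 : ℂ) • (1 +
    kleinPairing x (0, 1) • grpElt (permB hn) + (kleinPairing x (1, 0) • grpElt (permA hn) +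
      kleinPairing x (1, 1) • (grpElt (permA hn) * grpElt (permB hn)))) := by
  have : ∀ f : Klein → MonoidAlgebra ℂ (Equiv.Perm (Fin n)), ∑ k, f k =
      f (0, 0) + f (0, 1) + (f (1, 0) + f (1, 1)) := fun f => by
    rw [Fintype.sum_prod_type]
    exact (Fin.sum_univ_two _).trans
      (congrArg₂ _ (Fin.sum_univ_two _) (Fin.sum_univ_two _))
  rw [dualProj_eq, this]
  simp [kleinPerm, ZMod.val_one, grpElt_mul, grpElt_one, kleinPairing]

theorem dualProj_mul_permC_mul_ne_zero₁ :
    dualProj hn (1, 0) * grpElt (permC hn) * dualProj hn (1, 0) ≠ 0 := by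
  intro h
  -- The image of e₀ is (e₀ - e₁)/4.
  have := congrArg (fun x => permRep n x (stdVec hn 0) (Fin.castLE hn 0)) h
  simp [dualProj_eq_sum_four, permRep_permA, permRep_permB, permRep_permC, kleinPairing,
    ZMod.val_one, stdVec_apply, Equiv.swap_apply_def] at this

theorem dualProj_mul_permC_mul_ne_zero₂ :
    dualProj hn (0, 1) * grpElt (permC hn) * dualProj hn 0 ≠ 0 := by
  intro h
  -- The image of e₀ is (e₂ - e₃)/4.
  have := congrArg (fun x => permRep n x (stdVec hn 0) (Fin.castLE hn 2)) h
  simp [dualProj_eq_sum_four, permRep_permA, permRep_permB, permRep_permC, kleinPairing,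
    ZMod.val_one, stdVec_apply, Equiv.swap_apply_def] at this

theorem symGamma_mem_symGroup : symGamma hn ∈ symGroup hn := Or.inr rfl

theorem mem_fixedAlgebra_symGroup {x : MonoidAlgebra ℂ (Equiv.Perm (Fin n))}
    (hx : symGamma hn x = x) : x ∈ fixedAlgebra (symGroup hn) := by
  rintro γ (rfl | rfl)
  · rfl
  · exact hx

theorem symGamma_ne_one : symGamma hn ≠ 1 := by
  intro h
  have h' : permRep n (symGamma hn (grpElt (permC hn))) (stdVec hn 0) (Fin.castLE hn 0) =
      permRep n (grpElt (permC hn)) (stdVec hn 0) (Fin.castLE hn 0) := by rw [h]; rfl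
  simp [symGamma_apply, permRep_permA, permRep_permC, stdVec_apply, Equiv.swap_apply_def] at h'

theorem orderOf_symGamma : orderOf (symGamma hn) = 2 :=
  orderOf_eq_prime (by rw [pow_two, symGamma_mul_self]) (symGamma_ne_one hn)

open Classical in
theorem univ_symGroup : (Finset.univ : Finset (symGroup hn)) =
    {1, ⟨symGamma hn, symGamma_mem_symGroup hn⟩} := by
  ext ⟨γ, hγ⟩
  simp only [Finset.mem_univ, Finset.mem_insert, Finset.mem_singleton, true_iff]
  rcases hγ with rfl | rfl
  · exact Or.inl rfl
  · exact Or.inr rfl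

theorem one_ne_symGamma :
    (1 : symGroup hn) ≠ ⟨symGamma hn, symGamma_mem_symGroup hn⟩ := fun h =>
  symGamma_ne_one hn (congrArg Subtype.val h).symm

theorem card_symGroup : Fintype.card (symGroup hn) = 2 := by
  classical
  rw [← Finset.card_univ, univ_symGroup, Finset.card_pair (one_ne_symGamma hn)]

theorem coe_fixedExpectation_symGroup (x : MonoidAlgebra ℂ (Equiv.Perm (Fin n))) :
    (fixedExpectation (symGroup hn) x : MonoidAlgebra ℂ (Equiv.Perm (Fin n))) =
      (2 : ℂ)⁻¹ • (x + symGamma hn x) := by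
  classical
  rw [coe_fixedExpectation, card_symGroup, univ_symGroup, Finset.sum_pair (one_ne_symGamma hn)]
  rfl

theorem exists_mul_ne_mul : ∃ x y : fixedAlgebra (symGroup hn), x * y ≠ y * x := by
  have hβ : symGamma hn (grpElt (permB hn)) = grpElt (permB hn) := by
    rw [symGamma_grpElt, (permA_commute_permB hn).eq, mul_inv_cancel_right]
  refine ⟨fixedExpectation _ (grpElt (permC hn)),
    ⟨grpElt (permB hn), mem_fixedAlgebra_symGroup hn hβ⟩, fun h => ?_⟩
  -- One product sends e₃ to (e₀ + e₁)/2, the other sends it to e₂; they differ in the coefficient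
  -- of e₁.
  have := congrArg (fun x : fixedAlgebra (symGroup hn) =>
    permRep n (x : MonoidAlgebra ℂ (Equiv.Perm (Fin n))) (stdVec hn 3) (Fin.castLE hn 1)) h
  simp [coe_fixedExpectation_symGroup, symGamma_apply, permRep_permA, permRep_permB,
    permRep_permC, stdVec_apply, Equiv.swap_apply_def] at this

theorem map_fixedExpectation_mul_mul {A : Type*} [Ring A] [StarRing A] [Algebra ℂ A]
    [StarModule ℂ A] (Γ : Subgroup (A ≃⋆ₐ[ℂ] A)) [Fintype Γ] (p q r s : fixedAlgebra Γ)
    (t : A ⊗[ℂ] A) :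
    (p ⊗ₜ q) * TensorProduct.map (fixedExpectation Γ) (fixedExpectation Γ) t * (r ⊗ₜ s) =
      TensorProduct.map (fixedExpectation Γ) (fixedExpectation Γ)
        (((p : A) ⊗ₜ[ℂ] (q : A)) * t * ((r : A) ⊗ₜ[ℂ] (s : A))) := by
  induction t with
  | zero => simp
  | add x y hx hy => simp only [map_add, mul_add, add_mul, hx, hy]
  | tmul x y => simp [fixedExpectation_mul_coe, fixedExpectation_coe_mul]

theorem tensorFlip_map_fixedExpectation {A : Type*} [Ring A] [StarRing A] [Algebra ℂ A]
    [StarModule ℂ A] (Γ : Subgroup (A ≃⋆ₐ[ℂ] A)) [Fintype Γ] (t : A ⊗[ℂ] A) :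
    tensorFlip _ (TensorProduct.map (fixedExpectation Γ) (fixedExpectation Γ) t) =
      TensorProduct.map (fixedExpectation Γ) (fixedExpectation Γ) (tensorFlip A t) := by
  induction t with
  | zero => simp
  | add x y hx hy => simp only [map_add, hx, hy]
  | tmul x y => simp

theorem map_fixedExpectation_comul_apply {A : Type*} [Ring A] [StarRing A] [Algebra ℂ A]
    [StarModule ℂ A] {Γ : Subgroup (A ≃⋆ₐ[ℂ] A)} [Fintype Γ] {Δ : A →ₗ[ℂ] A ⊗[ℂ] A}
    {γ : A ≃⋆ₐ[ℂ] A} (hγ : γ ∈ Γ) (hΔ : ∀ a, Δ (γ a) = TensorProduct.map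
      (γ.toAlgEquiv.toLinearMap) (γ.toAlgEquiv.toLinearMap) (Δ a)) (a : A) :
    TensorProduct.map (fixedExpectation Γ) (fixedExpectation Γ) (Δ (γ a)) =
      TensorProduct.map (fixedExpectation Γ) (fixedExpectation Γ) (Δ a) := by
  rw [hΔ]
  induction Δ a with
  | zero => simp
  | add x y hx hy => simp only [map_add, hx, hy]
  | tmul x y => simp [fixedExpectation_apply_of_mem Γ hγ]

/-- As P ∘ γ = P, the elements a and γ(a) have the same image under (P ⊗ P)Δ_Ω, so it can be
computed from a alone. -/
theorem delsartComul_fixedExpectation_symGroup (a : MonoidAlgebra ℂ (Equiv.Perm (Fin n))) :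
    delsartComul (symGroup hn) (symComul hn) (fixedExpectation (symGroup hn) a) =
      TensorProduct.map (fixedExpectation (symGroup hn)) (fixedExpectation (symGroup hn))
        (symComul hn a) := by
  rw [delsartComul_apply, coe_fixedExpectation_symGroup, map_smul, map_smul, map_add, map_add,
    map_fixedExpectation_comul_apply (symGamma_mem_symGroup hn)
      (isKacAutomorphism_symGamma hn).comul, ← two_smul ℂ, smul_smul]
  norm_num

/-- On the corner P_x A P_y the automorphism γ is the scalar ⟨x, a⟩⟨y, a⟩; corners where this is 1
lie in the fixed algebra. -/
theorem symGamma_dualProj_mul_mul {x y : Klein}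
    (hxy : kleinPairing x (1, 0) * kleinPairing y (1, 0) = 1)
    (c : MonoidAlgebra ℂ (Equiv.Perm (Fin n))) :
    symGamma hn (dualProj hn x * c * dualProj hn y) = dualProj hn x * c * dualProj hn y := by
  rw [symGamma_apply, ← kleinPerm_one_zero, mul_assoc, mul_assoc, mul_assoc,
    dualProj_mul_grpElt_kleinPerm, ← mul_assoc, grpElt_kleinPerm_mul_dualProj, mul_smul_comm,
    mul_smul_comm, smul_mul_assoc, smul_smul, mul_comm, hxy, one_smul, mul_assoc]

theorem eq_zero_or_eq_zero_of_tmul_eq_zero {A : Type*} [Ring A] [Algebra ℂ A] {x y : A}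
    (h : x ⊗ₜ[ℂ] y = 0) : x = 0 ∨ y = 0 := by
  refine or_iff_not_imp_right.2 fun hy => (Module.forall_dual_apply_eq_zero_iff ℂ x).1 fun φ => ?_
  have := congrArg (sliceLeft φ) h
  rw [sliceLeft_tmul, map_zero] at this
  exact (smul_eq_zero.1 this).resolve_right hy

theorem tmul_mul_diagElt_mul (v w : Klein → Klein → ℂ) (x y x' y' : Klein)
    (c d : MonoidAlgebra ℂ (Equiv.Perm (Fin n))) :
    (dualProj hn x ⊗ₜ[ℂ] dualProj hn y) * (diagElt hn v * (c ⊗ₜ[ℂ] d) * diagElt hn w) *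
        (dualProj hn x' ⊗ₜ[ℂ] dualProj hn y') = (v x y * w x' y') •
      ((dualProj hn x * c * dualProj hn x') ⊗ₜ[ℂ] (dualProj hn y * d * dualProj hn y')) := by
  rw [← mul_assoc, ← mul_assoc, tmul_mul_diagElt, mul_assoc, diagElt_mul_tmul, smul_mul_assoc,
    smul_mul_assoc, mul_smul_comm, Algebra.TensorProduct.tmul_mul_tmul,
    Algebra.TensorProduct.tmul_mul_tmul, smul_smul]

/-- The flip exchanges Ω and Ω*. In a corner this replaces the weight ω(x, y) of the left factor by
its conjugate, so a corner with nonreal weight and nonzero content in B ⊗ B suffices. -/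
theorem tensorFlip_delsartComul_ne : tensorFlip _ ∘ₗ delsartComul (symGroup hn) (symComul hn) ≠
    delsartComul (symGroup hn) (symComul hn) := by
  intro h
  let p : Klein → fixedAlgebra (symGroup hn) := fun x =>
    ⟨dualProj hn x, mem_fixedAlgebra_symGroup hn (symGamma_dualProj hn x)⟩
  let c := grpElt (permC hn)
  have h₁ := LinearMap.congr_fun h (fixedExpectation (symGroup hn) c)
  rw [LinearMap.comp_apply, delsartComul_fixedExpectation_symGroup,
    tensorFlip_map_fixedExpectation, symComul_grpElt, tensorFlip_mul, tensorFlip_mul,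
    tensorFlip_symOmega, tensorFlip_star_symOmega, tensorFlip_tmul] at h₁
  -- The left weight is ω(â, b̂) = i against -i, and the right weight involves ê and equals 1. The
  -- pairs (â, â) and (b̂, ê) agree on a, so both tensor factors of the corner are fixed by γ.
  have h₂ := congrArg (fun t => (p (1, 0) ⊗ₜ[ℂ] p (0, 1)) * t * (p (1, 0) ⊗ₜ[ℂ] p 0)) h₁
  simp only [map_fixedExpectation_mul_mul] at h₂
  rw [star_symOmega, symOmega_eq] at h₂
  change TensorProduct.map _ _ ((dualProj hn (1, 0) ⊗ₜ[ℂ] dualProj hn (0, 1)) *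
    _ * (dualProj hn (1, 0) ⊗ₜ[ℂ] dualProj hn 0)) =
    TensorProduct.map _ _ ((dualProj hn (1, 0) ⊗ₜ[ℂ] dualProj hn (0, 1)) *
    _ * (dualProj hn (1, 0) ⊗ₜ[ℂ] dualProj hn 0)) at h₂
  rw [tmul_mul_diagElt_mul, tmul_mul_diagElt_mul, map_smul, map_smul] at h₂
  have hω₁ : kleinCocycle (1, 0) (0, 1) = Complex.I := by simp [kleinCocycle]
  have hω₂ : kleinCocycle (0, 1) (1, 0) = -Complex.I := by
    rw [← star_kleinCocycle, hω₁]
    simp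
  rw [hω₁, hω₂, kleinCocycle_zero_left, kleinCocycle_zero_right, ← sub_eq_zero, ← sub_smul,
    smul_eq_zero] at h₂
  have hI : -Complex.I * 1 - Complex.I * 1 ≠ 0 := fun h => by
    have := congrArg Complex.im h
    norm_num at this
  have h₃ := h₂.resolve_left hI
  rw [← (tensorStarHom_subtype_injective (Γ := symGroup hn)).eq_iff, map_zero] at h₃
  have hfix : ∀ z, symGamma hn z = z → (fixedExpectation (symGroup hn) z :
      MonoidAlgebra ℂ (Equiv.Perm (Fin n))) = z := fun z hz =>
    congrArg Subtype.val
      (fixedExpectation_coe (symGroup hn) ⟨z, mem_fixedAlgebra_symGroup hn hz⟩)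
  have h₄ : (dualProj hn (1, 0) * c * dualProj hn (1, 0)) ⊗ₜ[ℂ]
      (dualProj hn (0, 1) * c * dualProj hn 0) = 0 := by
    rw [← h₃, TensorProduct.map_tmul]
    change _ = (fixedExpectation (symGroup hn) _ : MonoidAlgebra ℂ (Equiv.Perm (Fin n))) ⊗ₜ[ℂ]
      (fixedExpectation (symGroup hn) _ : MonoidAlgebra ℂ (Equiv.Perm (Fin n)))
    rw [hfix, hfix]
    · exact symGamma_dualProj_mul_mul hn (by simp [kleinPairing]) _
    · exact symGamma_dualProj_mul_mul hn (by simp [kleinPairing, ZMod.val_one]) _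
  rcases eq_zero_or_eq_zero_of_tmul_eq_zero h₄ with h₅ | h₅
  · exact dualProj_mul_permC_mul_ne_zero₁ hn h₅
  · exact dualProj_mul_permC_mul_ne_zero₂ hn h₅

/-- P ⊗ P commutes with the flip, so symmetry of Δ_Ω would pass to the hypergroup. -/
theorem tensorFlip_symComul_ne : tensorFlip _ ∘ₗ symComul hn ≠ symComul hn := by
  intro h
  apply tensorFlip_delsartComul_ne hn
  ext1 b
  rw [LinearMap.comp_apply, delsartComul_apply, tensorFlip_map_fixedExpectation,
    ← LinearMap.comp_apply (tensorFlip _), h]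

end PermutationRepresentation

/-! ### The dimension of the fixed algebra. -/

section Dimension

/-- The rank of a projection is its trace, here the average of the traces of the automorphisms. -/
theorem finrank_fixedAlgebra {A : Type*} [Ring A] [StarRing A] [Algebra ℂ A] [StarModule ℂ A]
    [FiniteDimensional ℂ A] (Γ : Subgroup (A ≃⋆ₐ[ℂ] A)) [Fintype Γ] :
    (Module.finrank ℂ (fixedAlgebra Γ) : ℂ) = (Fintype.card Γ : ℂ)⁻¹ *
      ∑ γ : Γ, LinearMap.trace ℂ A (γ : A ≃⋆ₐ[ℂ] A).toAlgEquiv.toLinearMap := by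
  have h : LinearMap.IsProj (fixedAlgebra Γ).toSubalgebra.toSubmodule (fixedProjection Γ) :=
    ⟨fun a => (fixedExpectation Γ a).2, fun a ha =>
      congrArg Subtype.val (fixedExpectation_coe Γ ⟨a, ha⟩)⟩
  have h' : fixedProjection Γ = (Fintype.card Γ : ℂ)⁻¹ •
      ∑ γ : Γ, (γ : A ≃⋆ₐ[ℂ] A).toAlgEquiv.toLinearMap := by
    ext a
    simp [fixedProjection, coe_fixedExpectation]
  have := h.trace
  rw [h', map_smul, map_sum, smul_eq_mul] at this
  exact this.symm

instance finiteDimensional_groupAlgebra {G : Type*} [Finite G] :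
    FiniteDimensional ℂ (MonoidAlgebra ℂ G) :=
  Module.Basis.finiteDimensional_of_finite (MonoidAlgebra.basis G ℂ)

variable {n : ℕ} (hn : 4 ≤ n)

/-- The automorphism permutes the basis λ(g), so its trace counts the g that commute with (12). -/
theorem trace_symGamma : LinearMap.trace ℂ _ (symGamma hn).toAlgEquiv.toLinearMap =
    (Nat.card (Subgroup.centralizer {permA hn}) : ℂ) := by
  classical
  rw [LinearMap.trace_eq_matrix_trace ℂ (MonoidAlgebra.basis (Equiv.Perm (Fin n)) ℂ), Matrix.trace]
  have h : ∀ g, (LinearMap.toMatrix (MonoidAlgebra.basis (Equiv.Perm (Fin n)) ℂ)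
      (MonoidAlgebra.basis (Equiv.Perm (Fin n)) ℂ)
      (symGamma hn).toAlgEquiv.toLinearMap).diag g =
      if g ∈ Subgroup.centralizer {permA hn} then 1 else 0 := fun g => by
    rw [Matrix.diag_apply, LinearMap.toMatrix_apply]
    change (symGamma hn (grpElt g)).coeff g = _
    rw [symGamma_grpElt, grpElt, MonoidAlgebra.coeff_single, Finsupp.single_apply]
    congr 1
    rw [Subgroup.mem_centralizer_singleton_iff, mul_inv_eq_iff_eq_mul]
    exact propext eq_comm
  rw [Finset.sum_congr rfl fun g _ => h g, Finset.sum_boole, Nat.card_eq_fintype_card,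
    Fintype.card_subtype]

theorem card_centralizer_permA :
    Nat.card (Subgroup.centralizer {permA hn}) = (n - 2).factorial * 2 := by
  have hc : (permA hn).cycleType = {2} := by
    rw [← Equiv.Perm.isSwap_iff_cycleType]
    exact ⟨_, _, by simp, rfl⟩
  rw [Equiv.Perm.nat_card_centralizer, hc]
  simp

theorem finrank_fixedAlgebra_symGroup :
    (Module.finrank ℂ (fixedAlgebra (symGroup hn)) : ℚ) =
      1 / 2 * ((n : ℚ) ^ 2 - n + 2) * (n - 2).factorial := by
  classical
  have h := finrank_fixedAlgebra (symGroup hn)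
  rw [card_symGroup, univ_symGroup, Finset.sum_pair (one_ne_symGamma hn), trace_symGamma,
    card_centralizer_permA] at h
  have h1 : LinearMap.trace ℂ (MonoidAlgebra ℂ (Equiv.Perm (Fin n)))
      ((1 : symGroup hn) : _ ≃⋆ₐ[ℂ] _).toAlgEquiv.toLinearMap = (n.factorial : ℂ) := by
    refine (LinearMap.trace_id ℂ _).trans ?_
    rw [Module.finrank_eq_card_basis (MonoidAlgebra.basis (Equiv.Perm (Fin n)) ℂ),
      Fintype.card_perm, Fintype.card_fin]
  rw [h1] at h
  have hfac : n.factorial = n * (n - 1) * (n - 2).factorial := by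
    obtain ⟨m, rfl⟩ : ∃ m, n = m + 2 := ⟨n - 2, by omega⟩
    simp [Nat.factorial_succ, mul_assoc]
  have hq : (Module.finrank ℂ (fixedAlgebra (symGroup hn)) : ℚ) =
      (2 : ℚ)⁻¹ * (n.factorial + (n - 2).factorial * 2) := by
    have : ((Module.finrank ℂ (fixedAlgebra (symGroup hn)) : ℚ) : ℂ) =
      (((2 : ℚ)⁻¹ * (n.factorial + (n - 2).factorial * 2) : ℚ) : ℂ) := by
      push_cast at h ⊢
      exact h
    exact_mod_cast this
  rw [hq, hfac]
  push_cast [Nat.cast_sub (show 1 ≤ n by omega)]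
  ring

end Dimension

theorem mainTheorem10 (n : ℕ) (hn : 4 ≤ n) :
    IsCounitalTwoCocycle (Coalgebra.comul (R := ℂ)) (symCounit n) (symOmega hn) ∧
    IsKacAlgebra (symComul hn) (symCounit n) (symAntipode hn) (groupTrace (Equiv.Perm (Fin n))) ∧
    tensorFlip _ ∘ₗ symComul hn ≠ symComul hn ∧
    IsKacAutomorphism (symComul hn) (symCounit n) (symAntipode hn) (symGamma hn) ∧
    orderOf (symGamma hn) = 2 ∧
    IsDelsartHypergroup (symGroup hn) (symComul hn) (symCounit n) (symAntipode hn)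
      (groupTrace (Equiv.Perm (Fin n))) ∧
    (∃ x y : fixedAlgebra (symGroup hn), x * y ≠ y * x) ∧
    (Module.finrank ℂ (fixedAlgebra (symGroup hn)) : ℚ) =
      1 / 2 * ((n : ℚ) ^ 2 - n + 2) * (n - 2).factorial ∧
    tensorFlip _ ∘ₗ delsartComul (symGroup hn) (symComul hn) ≠
      delsartComul (symGroup hn) (symComul hn) :=
  ⟨isCounitalTwoCocycle_symOmega hn, isKacAlgebra_symComul hn, tensorFlip_symComul_ne hn,
    isKacAutomorphism_symGamma hn, orderOf_symGamma hn, isDelsartHypergroup_symGroup hn,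
    exists_mul_ne_mul hn, finrank_fixedAlgebra_symGroup hn, tensorFlip_delsartComul_ne hn⟩
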